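/- Let $n,K,m$ be natural numbers with $n=Km$ and put $$\mathcal H=\{H\in\{0,1\}^{n\times K}:\ H\mathbf 1_K=\mathbf 1_n,\ H^{T}\mathbf 1_n=m\mathbf 1_K\}$$ (the balanced clustering matrices). For $C\in\mathbb R^{n\times K}$ let $\mathcal T(C)=\arg\min\{\|H-C\|_F:\ H\in\mathcal H\}$, the set of all projections of $C$ onto $\mathcal H$. For $C\in\mathbb R^{n\times K}$ and $\pi\in\mathbb Z_{\ge 0}^K$ with $\sum_k\pi_k=n$, the minimum-cost $\pi$-assignment problem with cost matrix $C$ asks for a subgraph $G$, containing all nodes, of the complete bipartite graph on $\{u_1,\dots,u_n\}\cup\{v_1,\dots,v_K\}$, in which every $u_i$ has degree $1$ and every $v_k$ has degree $\pi_k$ (call such a $G$ a $\pi$-assignment), and whose total cost $\sum_{u_iv_k\in E(G)}c_{ik}$ is minimal. Let $H_G\in\{0,1\}^{n\times K}$ be the matrix with $(H_G)_{ik}=1$ if and only if $u_iv_k\in E(G)$. 1. (Equivalence.) For every $C\in\mathbb R^{n\times K}$, computing a projection of $C$ onto $\mathcal H$ is equivalent to the minimum-cost $\pi$-assignment problem with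 cost matrix $-C$ and $\pi=m\mathbf 1_K$: the map $G\mapsto H_G$ is a bijection from the $m\mathbf 1_K$-assignments onto $\mathcal H$; for any two $m\mathbf 1_K$-assignments $G,G'$, $\|H_G-C\|_F\le\|H_{G'}-C\|_F$ if and only if the cost of $G$ with respect to $-C$ is at most that of $G'$; and $G\mapsto H_G$ restricts to a bijection from the optimal assignments onto $\mathcal T(C)$. 2. (Running time.) Consider the real RAM, in which each access to an integer or real array, each addition or subtraction of integers or of real numbers, each comparison, each Boolean operation and each assignment costs one step. There are a program and a constant $c$ such that for all $n\ge 2$, all $K$, all $\pi\in\mathbb Z_{\ge0}^K$ with $\sum_k\pi_k=n$ and all $C\in\mathbb R^{n\times K}$, the program, given $(n,K,\pi,C)$, halts within $c\,K^2n\log n$ steps and outputs the matrix $H_G$ of an optimal solution $G$ of the minimum-cost $\pi$-assignment problem with cost matrix $C$. Consequently, there are a program and a constant $c$ such that for all $n\ge 2$ and $K$ with $n=Km$ for some natural number $m$, and all $C\in\mathbb R^{n\times K}$, the program, given $(n,K,C)$, halts within $c\,K^2n\log n$ steps and outputs an element of $\mathcal T(C)$. -/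

import Mathlib

/-! ### The projection problem -/

namespace Clustering

section
attribute [local instance] Matrix.frobeniusNormedAddCommGroup

/-- The Frobenius norm of a real matrix. -/
noncomputable def frobNorm {n K : ℕ} (A : Matrix (Fin n) (Fin K) ℝ) : ℝ := ‖A‖

end

/-- The discrete feasible set `𝓗` of balanced clustering matrices: matrices `H` with `H 1 = 1`,
`Hᵀ 1 = m 1` and all entries in `{0, 1}`. -/
def feasible (n K m : ℕ) : Set (Matrix (Fin n) (Fin K) ℝ) :=
  {H | H.mulVec (fun _ => 1) = (fun _ => 1) ∧
    H.transpose.mulVec (fun _ => 1) = (fun _ => (m : ℝ)) ∧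
    ∀ i k, H i k = 0 ∨ H i k = 1}

/-- The projection `𝓣(C)`: the set of all minimizers of `‖H - C‖_F` over `H ∈ 𝓗`. -/
def proj {n K : ℕ} (m : ℕ) (C : Matrix (Fin n) (Fin K) ℝ) : Set (Matrix (Fin n) (Fin K) ℝ) :=
  {H | H ∈ feasible n K m ∧ ∀ H' ∈ feasible n K m, frobNorm (H - C) ≤ frobNorm (H' - C)}

end Clustering

/-! ### The minimum-cost assignment problem -/

namespace MCAP

/-- A subgraph of the complete bipartite graph with parts `u_1, …, u_n` (left summand) and
`v_1, …, v_K` (right summand). -/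
abbrev BipSubgraph (n K : ℕ) : Type := (completeBipartiteGraph (Fin n) (Fin K)).Subgraph

/-- A `π`-assignment: the node set is everything, each `u_i` has degree `1`, each `v_k` has
degree `π_k`. -/
def IsAssignment {n K : ℕ} (π : Fin K → ℕ) (G : BipSubgraph n K) : Prop :=
  G.verts = Set.univ ∧
  (∀ i : Fin n, (G.neighborSet (Sum.inl i)).ncard = 1) ∧
  (∀ k : Fin K, (G.neighborSet (Sum.inr k)).ncard = π k)

open Classical in
/-- The total cost of the edges of `G`. -/
noncomputable def cost {n K : ℕ} (C : Matrix (Fin n) (Fin K) ℝ) (G : BipSubgraph n K) : ℝ :=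
  ∑ i, ∑ k, if G.Adj (Sum.inl i) (Sum.inr k) then C i k else 0

/-- `G` solves the minimum-cost `π`-assignment problem with cost matrix `C`. -/
def IsMinCostAssignment {n K : ℕ} (C : Matrix (Fin n) (Fin K) ℝ) (π : Fin K → ℕ)
    (G : BipSubgraph n K) : Prop :=
  IsAssignment π G ∧ ∀ G' : BipSubgraph n K, IsAssignment π G' → cost C G ≤ cost C G'

open Classical in
/-- The `n × K` zero-one matrix of a subgraph of the complete bipartite graph. -/
noncomputable def biadjacency {n K : ℕ} (G : BipSubgraph n K) : Matrix (Fin n) (Fin K) ℝ :=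
  Matrix.of fun i k => if G.Adj (Sum.inl i) (Sum.inr k) then 1 else 0

end MCAP

/-! ### The real RAM with unit costs

A program works on finitely many named integer arrays and real arrays (a scalar variable is a cell
of an array). Every array access, integer addition or subtraction, real addition or subtraction,
comparison, Boolean operation and assignment costs one step. Integer and real data are kept apart:
there is no rounding, real numbers cannot serve as addresses, and there is no multiplication. -/

namespace RealRAM

/-- Memory: cell `i` of the integer array `a` is `int a i`, that of the real array `a` is
`real a i`. -/
structure State where
  int : ℕ → ℕ → ℕ
  real : ℕ → ℕ → ℝ

/-- Integer expressions: constants, array cells (with computed index), sum, truncated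
difference. -/
inductive IExpr where
  | const (z : ℕ)
  | get (a : ℕ) (i : IExpr)
  | add (e f : IExpr)
  | sub (e f : IExpr)

/-- Real expressions: array cells (with computed index), sum, difference. -/
inductive RExpr where
  | get (a : ℕ) (i : IExpr)
  | add (e f : RExpr)
  | sub (e f : RExpr)

/-- Tests: comparisons of integers or of reals, negation, conjunction. -/
inductive Test where
  | ilt (e f : IExpr)
  | rlt (e f : RExpr)
  | not (b : Test)
  | and (b c : Test)

def IExpr.eval (s : State) : IExpr → ℕ
  | .const z => z
  | .get a i => s.int a (i.eval s)
  | .add e f => e.eval s + f.eval s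
  | .sub e f => e.eval s - f.eval s

noncomputable def RExpr.eval (s : State) : RExpr → ℝ
  | .get a i => s.real a (i.eval s)
  | .add e f => e.eval s + f.eval s
  | .sub e f => e.eval s - f.eval s

def Test.Holds (s : State) : Test → Prop
  | .ilt e f => e.eval s < f.eval s
  | .rlt e f => e.eval s < f.eval s
  | .not b => ¬ b.Holds s
  | .and b c => b.Holds s ∧ c.Holds s

/-- Number of steps needed to evaluate an integer expression. -/
def IExpr.cost : IExpr → ℕ
  | .const _ => 1
  | .get _ i => i.cost + 1
  | .add e f => e.cost + f.cost + 1
  | .sub e f => e.cost + f.cost + 1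

/-- Number of steps needed to evaluate a real expression. -/
def RExpr.cost : RExpr → ℕ
  | .get _ i => i.cost + 1
  | .add e f => e.cost + f.cost + 1
  | .sub e f => e.cost + f.cost + 1

/-- Number of steps needed to evaluate a test. -/
def Test.cost : Test → ℕ
  | .ilt e f => e.cost + f.cost + 1
  | .rlt e f => e.cost + f.cost + 1
  | .not b => b.cost + 1
  | .and b c => b.cost + c.cost + 1

/-- Programs. -/
inductive Prog where
  | skip
  | iset (a : ℕ) (i : IExpr) (e : IExpr)
  | rset (a : ℕ) (i : IExpr) (e : RExpr)
  | seq (p q : Prog)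
  | cond (b : Test) (p q : Prog)
  | loop (b : Test) (p : Prog)

/-- Write `z` into cell `i` of the integer array `a`. -/
def State.setInt (s : State) (a i z : ℕ) : State :=
  { s with int := Function.update s.int a (Function.update (s.int a) i z) }

/-- Write `x` into cell `i` of the real array `a`. -/
noncomputable def State.setReal (s : State) (a i : ℕ) (x : ℝ) : State :=
  { s with real := Function.update s.real a (Function.update (s.real a) i x) }

/-- `Run p s t s'`: started in the state `s`, the program `p` halts after exactly `t` steps in the
state `s'`. -/
inductive Run : Prog → State → ℕ → State → Prop
  | skip (s : State) : Run .skip s 1 s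
  | iset (s : State) (a : ℕ) (i e : IExpr) :
      Run (.iset a i e) s (i.cost + e.cost + 1) (s.setInt a (i.eval s) (e.eval s))
  | rset (s : State) (a : ℕ) (i : IExpr) (e : RExpr) :
      Run (.rset a i e) s (i.cost + e.cost + 1) (s.setReal a (i.eval s) (e.eval s))
  | seq {p q : Prog} {s s' s'' : State} {t t' : ℕ} :
      Run p s t s' → Run q s' t' s'' → Run (.seq p q) s (t + t') s''
  | cond_true {b : Test} {p q : Prog} {s s' : State} {t : ℕ} :
      b.Holds s → Run p s t s' → Run (.cond b p q) s (b.cost + t) s'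
  | cond_false {b : Test} {p q : Prog} {s s' : State} {t : ℕ} :
      ¬ b.Holds s → Run q s t s' → Run (.cond b p q) s (b.cost + t) s'
  | loop_done {b : Test} {p : Prog} {s : State} :
      ¬ b.Holds s → Run (.loop b p) s b.cost s
  | loop_step {b : Test} {p : Prog} {s s' s'' : State} {t t' : ℕ} :
      b.Holds s → Run p s t s' → Run (.loop b p) s' t' s'' →
      Run (.loop b p) s (b.cost + t + t') s''

/-- The memory holding a finite real matrix row by row in real array `0`, its numbers of rows and
columns in cell `0` of the integer arrays `0` and `1`, a vector of naturals indexed by the columns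
in integer array `2`, and zeros everywhere else. -/
noncomputable def inputState {n K : ℕ} (C : Matrix (Fin n) (Fin K) ℝ) (π : Fin K → ℕ) : State where
  int := fun a j =>
    if a = 0 ∧ j = 0 then n
    else if a = 1 ∧ j = 0 then K
    else if h : a = 2 ∧ j < K then π ⟨j, h.2⟩
    else 0
  real := fun a j =>
    if h : a = 0 ∧ j < n * K then
      C ⟨j / K, Nat.div_lt_of_lt_mul (by rw [Nat.mul_comm]; exact h.2)⟩
        ⟨j % K, Nat.mod_lt _ (Nat.pos_of_ne_zero (by rintro rfl; simp at h))⟩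
    else 0

/-- The output of a computation: the `n × K` matrix that integer array `3` holds row by row. -/
def outputMatrix (n K : ℕ) (s : State) : Matrix (Fin n) (Fin K) ℝ :=
  Matrix.of fun i k => (s.int 3 ((i : ℕ) * K + (k : ℕ)) : ℝ)

/-- On the input state `s`, the program `p` halts within `T` steps, and its `n × K` output matrix
lies in `S`. -/
def OutputsWithin {n K : ℕ} (p : Prog) (s : State) (T : ℝ)
    (S : Set (Matrix (Fin n) (Fin K) ℝ)) : Prop :=
  ∃ (t : ℕ) (s' : State), Run p s t s' ∧ (t : ℝ) ≤ T ∧ outputMatrix n K s' ∈ S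

end RealRAM

namespace RealRAM

/-! ### A program logic with step bounds -/

/-! Equivalence. A zero-one matrix with a single 1 in each row is a function from rows to columns,
and so is a `π`-assignment; the column conditions prescribe the fibre sizes. For such `H` one has
`(h - c)² = h (1 - 2 c) + c²` entrywise, so the squared distance to `C` is a constant plus twice the
cost with respect to `-C` (`MCAP.sum_sq_biadjacency_sub`). Both problems therefore order the
candidates in the same way.

Running time. Rows are inserted one by one along shortest augmenting paths, with column potentials
`v` such that each placed row `r` sits in a column minimizing `c r q - v q` (`DualFeasible`). The
sum of `v (a r)` depends only on the column sizes, so such an assignment is cheapest among those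
with its column sizes (`DualFeasible.cost_le`). It remains to keep this invariant until all rows are
placed and the sizes are `π`.

Shifting a row `r` from column `k` to column `l` changes the cost by `c r l - c r k`. The search for
a new row therefore takes place on the `K` columns only, the edge from `k` to `l` having as length
the minimum of this difference over the rows in `k`. The potentials make reduced lengths
nonnegative, so Dijkstra's algorithm finds a shortest path to a column with free capacity
(`Labels.step`). A change of potentials by the distances makes the edges of the path tight
(`Labels.moving`), and shifting rows across tight edges preserves the invariant (`Moving.step`).

For each ordered pair of columns a tournament tree holds the row attaining the edge length at its
root. A search then costs `O(K²)`, since each of at most `K` visits reads `K` roots (`ends_relax`).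
The path causes at most `K + 1` shifts, and each shift updates at most two trees for every second
column, in `O(K log n)` steps (`ends_moveRow`). This gives `O(K² log n)` per row. All programs are
verified in a logic of total correctness with step bounds, `Ends`. -/

/-- Started in `s`, the program `p` halts within `T` steps in a state satisfying `Q`. -/
def Ends (p : Prog) (s : State) (T : ℕ) (Q : State → Prop) : Prop :=
  ∃ (t : ℕ) (s' : State), Run p s t s' ∧ t ≤ T ∧ Q s'

theorem Ends.mono {p : Prog} {s : State} {T T' : ℕ} {Q Q' : State → Prop} (h : Ends p s T Q)
    (hT : T ≤ T') (hQ : ∀ s', Q s' → Q' s') : Ends p s T' Q' := by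
  obtain ⟨t, s', hr, ht, hq⟩ := h
  exact ⟨t, s', hr, ht.trans hT, hQ _ hq⟩

theorem Ends.weaken {p : Prog} {s : State} {T T' : ℕ} {Q : State → Prop} (h : Ends p s T Q)
    (hT : T ≤ T') : Ends p s T' Q := h.mono hT fun _ => id

theorem Ends.seq {p q : Prog} {s : State} {T T' : ℕ} {Q R : State → Prop} (h : Ends p s T R)
    (h' : ∀ s', R s' → Ends q s' T' Q) : Ends (.seq p q) s (T + T') Q := by
  obtain ⟨t, s', hr, ht, hR⟩ := h
  obtain ⟨t', s'', hr', ht', hQ⟩ := h' s' hR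
  exact ⟨t + t', s'', .seq hr hr', by omega, hQ⟩

theorem Ends.cond {b : Test} {p q : Prog} {s : State} {T : ℕ} {Q : State → Prop}
    (hp : b.Holds s → Ends p s T Q) (hq : ¬ b.Holds s → Ends q s T Q) :
    Ends (.cond b p q) s (b.cost + T) Q := by
  by_cases hb : b.Holds s
  · obtain ⟨t, s', hr, ht, hQ⟩ := hp hb
    exact ⟨b.cost + t, s', .cond_true hb hr, by omega, hQ⟩
  · obtain ⟨t, s', hr, ht, hQ⟩ := hq hb
    exact ⟨b.cost + t, s', .cond_false hb hr, by omega, hQ⟩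

/-- Strong induction on the variant `m`: every pass lowers it, so there are at most `m` passes,
followed by one failing test. -/
theorem Ends.loop {b : Test} {p : Prog} {T : ℕ} {Q : State → Prop} (I : ℕ → State → Prop)
    (step : ∀ m s, I m s → b.Holds s → Ends p s T fun s' => ∃ m' < m, I m' s')
    (done : ∀ m s, I m s → ¬ b.Holds s → Q s) {m : ℕ} {s : State} (h : I m s) :
    Ends (.loop b p) s (m * (T + b.cost) + b.cost) Q := by
  induction m using Nat.strong_induction_on generalizing s with
  | _ m ih =>
    by_cases hb : b.Holds s
    · obtain ⟨t, s', hr, ht, m', hm, hI⟩ := step m s h hb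
      obtain ⟨t', s'', hr', ht', hQ⟩ := ih m' hm hI
      refine ⟨b.cost + t + t', s'', .loop_step hb hr hr', ?_, hQ⟩
      have : (m' + 1) * (T + b.cost) ≤ m * (T + b.cost) := Nat.mul_le_mul_right _ hm
      rw [Nat.succ_mul] at this
      omega
    · exact ⟨b.cost, s, .loop_done hb, by omega, done m s h hb⟩

/-! ### Loop-free programs and counting loops -/

/-- Effect of a program without loops. -/
noncomputable def Prog.exec : Prog → State → State
  | .skip, s => s
  | .iset a i e, s => s.setInt a (i.eval s) (e.eval s)
  | .rset a i e, s => s.setReal a (i.eval s) (e.eval s)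
  | .seq p q, s => q.exec (p.exec s)
  | .cond b p q, s => open Classical in if b.Holds s then p.exec s else q.exec s
  | .loop _ _, s => s

/-- The program has no loops. -/
def Prog.Straight : Prog → Prop
  | .seq p q => p.Straight ∧ q.Straight
  | .cond _ p q => p.Straight ∧ q.Straight
  | .loop _ _ => False
  | _ => True

/-- A bound for the number of steps of a program without loops. -/
def Prog.steps : Prog → ℕ
  | .skip => 1
  | .iset _ i e => i.cost + e.cost + 1
  | .rset _ i e => i.cost + e.cost + 1
  | .seq p q => p.steps + q.steps
  | .cond b p q => b.cost + max p.steps q.steps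
  | .loop _ _ => 0

/-- Reduces a loop-free program to a computation of its final state by `exec`; a conditional is
charged for its longer branch. -/
theorem Ends.straight {p : Prog} {s : State} {Q : State → Prop} (hp : p.Straight)
    (h : Q (p.exec s)) : Ends p s p.steps Q := by
  induction p generalizing s Q with
  | skip => exact ⟨_, _, .skip s, le_rfl, h⟩
  | iset a i e => exact ⟨_, _, .iset s a i e, le_rfl, h⟩
  | rset a i e => exact ⟨_, _, .rset s a i e, le_rfl, h⟩
  | seq p q ihp ihq => exact (ihp hp.1 (Q := fun s' => Q (q.exec s')) h).seq fun s' hs => ihq hp.2 hs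
  | cond b p q ihp ihq =>
    refine Ends.cond (fun hb => (ihp hp.1 ?_).weaken (le_max_left _ _))
      (fun hb => (ihq hp.2 ?_).weaken (le_max_right _ _))
    · simpa [Prog.exec, hb] using h
    · simpa [Prog.exec, hb] using h
  | loop => exact hp.elim

/-- The value of the integer scalar `a`. -/
abbrev IExpr.var (a : ℕ) : IExpr := .get a (.const 0)

/-- Disjunction of tests. -/
abbrev Test.or (b c : Test) : Test := .not (.and (.not b) (.not c))

/-- `for x = 0, …, e - 1 do p`. -/
def Prog.forRange (x : ℕ) (e : IExpr) (p : Prog) : Prog :=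
  .seq (.iset x (.const 0) (.const 0))
    (.loop (.ilt (.var x) e) (.seq p (.iset x (.const 0) (.add (.var x) (.const 1)))))

@[simp] theorem setInt_int_same (s : State) (a i z : ℕ) :
    (s.setInt a i z).int a = Function.update (s.int a) i z := by simp [State.setInt]

@[simp] theorem setInt_int_of_ne (s : State) {a b : ℕ} (i z : ℕ) (h : b ≠ a) :
    (s.setInt a i z).int b = s.int b := by simp [State.setInt, h]

@[simp] theorem setInt_real (s : State) (a i z : ℕ) : (s.setInt a i z).real = s.real := rfl

@[simp] theorem setReal_real_same (s : State) (a i : ℕ) (z : ℝ) :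
    (s.setReal a i z).real a = Function.update (s.real a) i z := by simp [State.setReal]

@[simp] theorem setReal_real_of_ne (s : State) {a b : ℕ} (i : ℕ) (z : ℝ) (h : b ≠ a) :
    (s.setReal a i z).real b = s.real b := by simp [State.setReal, h]

@[simp] theorem setReal_int (s : State) (a i : ℕ) (z : ℝ) : (s.setReal a i z).int = s.int := rfl

theorem setInt_setInt_same (s : State) (a i z w : ℕ) :
    (s.setInt a i z).setInt a i w = s.setInt a i w := by simp [State.setInt]

/-- The bound `e` is evaluated anew at each test, so it has to keep the value `N` under the
invariant. A pass costs `T`, plus 6 for the increment and `e.cost + 3` for the test; initialization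
and last test give `e.cost + 6`. -/
theorem Ends.forRange {x : ℕ} {e : IExpr} {p : Prog} {s : State} {T N : ℕ}
    (I : ℕ → State → Prop) (hN : ∀ j s, I j s → e.eval s = N)
    (hx : ∀ j s, I j s → s.int x 0 = j) (h0 : I 0 (s.setInt x 0 0))
    (step : ∀ j s, j < N → I j s →
      Ends p s T fun s' => s'.int x 0 = j ∧ I (j + 1) (s'.setInt x 0 (j + 1))) :
    Ends (.forRange x e p) s (N * (T + e.cost + 9) + e.cost + 6) (I N) := by
  refine ((Ends.straight (p := .iset x (.const 0) (.const 0)) (s := s) (Q := I 0) trivial h0).seq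
    fun s' hs' =>
    -- The variant is the number of remaining passes, so the counter is `N - m`.
    Ends.loop (T := T + 6) (fun m s => m ≤ N ∧ I (N - m) s) (m := N) ?_ ?_ ?_).weaken
    (T' := N * (T + e.cost + 9) + e.cost + 6) ?_
  · rintro m s ⟨hm, hI⟩ hb
    have hb' : N - m < N := by
      have : s.int x 0 < e.eval s := hb
      rwa [hN _ _ hI, hx _ _ hI] at this
    refine (step _ _ hb' hI).seq fun s' hs => (Ends.straight (by trivial) ?_).weaken (le_refl 6)
    refine ⟨m - 1, by omega, by omega, ?_⟩
    have : N - (m - 1) = N - m + 1 := by omega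
    rw [this]
    simpa [Prog.exec, IExpr.eval, hs.1] using hs.2
  · rintro m s ⟨hm, hI⟩ hb
    have : ¬ s.int x 0 < e.eval s := hb
    rw [hN _ _ hI, hx _ _ hI] at this
    have : N - m = N := by omega
    rwa [this] at hI
  · simpa using hs'
  · simp only [Prog.steps, IExpr.cost, Test.cost]
    nlinarith

/-! ### Frame conditions -/

/-- `s'` differs from `s` at most in the integer arrays `I` and the real arrays `R`. -/
structure Frame (I R : List ℕ) (s s' : State) : Prop where
  int : ∀ {a}, a ∉ I → s'.int a = s.int a
  real : ∀ {a}, a ∉ R → s'.real a = s.real a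

theorem Frame.refl (I R : List ℕ) (s : State) : Frame I R s s := ⟨fun _ => rfl, fun _ => rfl⟩

theorem Frame.trans {I R : List ℕ} {s s' s'' : State} (h : Frame I R s s') (h' : Frame I R s' s'') :
    Frame I R s s'' :=
  ⟨fun ha => (h'.int ha).trans (h.int ha), fun ha => (h'.real ha).trans (h.real ha)⟩

theorem Frame.mono {I R I' R' : List ℕ} {s s' : State} (h : Frame I R s s') (hI : I ⊆ I')
    (hR : R ⊆ R') : Frame I' R' s s' :=
  ⟨fun ha => h.int fun h => ha (hI h), fun ha => h.real fun h => ha (hR h)⟩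

theorem Frame.setInt {I R : List ℕ} {s s' : State} (h : Frame I R s s') {a : ℕ} (ha : a ∈ I)
    (i z : ℕ) : Frame I R s (s'.setInt a i z) :=
  ⟨fun {b} hb => by rw [setInt_int_of_ne _ _ _ (by rintro rfl; exact hb ha), h.int hb],
    fun hb => h.real hb⟩

theorem Frame.setReal {I R : List ℕ} {s s' : State} (h : Frame I R s s') {a : ℕ} (ha : a ∈ R)
    (i : ℕ) (z : ℝ) : Frame I R s (s'.setReal a i z) :=
  ⟨fun hb => h.int hb,
    fun {b} hb => by rw [setReal_real_of_ne _ _ _ (by rintro rfl; exact hb ha), h.real hb]⟩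

/-! ### Tournament trees

A tournament tree on `n` leaves is stored in the cells `1, …, 2 n - 1` of an array: the children of
the node `j < n` are `2 j` and `2 j + 1`, the leaf of `i` is the node `n + i`. A node holds `i + 1`,
where `i` is the element of least key among the active leaves below, and `0` if there are none. -/

open Classical in
/-- The better of two node values. -/
noncomputable def better (key : ℕ → ℝ) (p q : ℕ) : ℕ :=
  if q ≠ 0 ∧ (p = 0 ∨ key (q - 1) < key (p - 1)) then q else p

/-- The array `τ` holds a tournament tree on `n` leaves with active set `S`. -/
structure Tournament (n : ℕ) (key : ℕ → ℝ) (S : ℕ → Prop) (τ : ℕ → ℕ) : Prop where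
  leaf : ∀ i < n, (S i → τ (n + i) = i + 1) ∧ (¬ S i → τ (n + i) = 0)
  node : ∀ j, 1 ≤ j → j < n → τ j = better key (τ (2 * j)) (τ (2 * j + 1))

theorem Tournament.congr {n : ℕ} {key : ℕ → ℝ} {S S' : ℕ → Prop} {τ τ' : ℕ → ℕ}
    (h : Tournament n key S τ) (hS : ∀ i < n, S i ↔ S' i) (hτ : ∀ j < 2 * n, τ' j = τ j) :
    Tournament n key S' τ' := by
  refine ⟨fun i hi => ?_, fun j h1 hj => ?_⟩
  · rw [← hS i hi, hτ _ (by omega)]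
    exact h.leaf i hi
  · rw [hτ _ (by omega), hτ _ (by omega), hτ _ (by omega)]
    exact h.node j h1 hj

/-- A nonzero value is copied from a child, hence comes from an active leaf. Children have larger
indices, so the induction is on `2 * n - j`. -/
theorem Tournament.active {n : ℕ} {key : ℕ → ℝ} {S : ℕ → Prop} {τ : ℕ → ℕ}
    (h : Tournament n key S τ) {j : ℕ} (h1 : 1 ≤ j) (hj : j < 2 * n) (h0 : τ j ≠ 0) :
    τ j - 1 < n ∧ S (τ j - 1) := by
  obtain ⟨d, hd⟩ : ∃ d, d = 2 * n - j := ⟨_, rfl⟩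
  induction d using Nat.strong_induction_on generalizing j with
  | _ d ih =>
    by_cases hjn : j < n
    · have := h.node j h1 hjn
      unfold better at this
      split_ifs at this with hc
      · rw [this] at h0 ⊢
        exact ih _ (by omega) (by omega) (by omega) h0 rfl
      · rw [this] at h0 ⊢
        exact ih _ (by omega) (by omega) (by omega) h0 rfl
    · obtain ⟨i, rfl⟩ := Nat.exists_eq_add_of_le (not_lt.1 hjn)
      have hl := h.leaf i (by omega)
      by_cases hS : S i
      · rw [hl.1 hS]
        exact ⟨by simp; omega, by simpa⟩
      · exact absurd (hl.2 hS) h0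

/-- Climb from `j` to `j / 2`: the winner stays nonzero and its key does not increase. -/
theorem Tournament.root_le {n : ℕ} {key : ℕ → ℝ} {S : ℕ → Prop} {τ : ℕ → ℕ}
    (h : Tournament n key S τ) {j : ℕ} (h1 : 1 ≤ j) (hj : j < 2 * n) (h0 : τ j ≠ 0) :
    τ 1 ≠ 0 ∧ key (τ 1 - 1) ≤ key (τ j - 1) := by
  induction j using Nat.strong_induction_on with
  | _ j ih =>
    rcases Nat.eq_or_lt_of_le h1 with rfl | h2
    · exact ⟨h0, le_rfl⟩
    · have hp := h.node (j / 2) (by omega) (by omega)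
      have key_le : τ (j / 2) ≠ 0 ∧ key (τ (j / 2) - 1) ≤ key (τ j - 1) := by
        unfold better at hp
        rcases Nat.even_or_odd' j with ⟨m, rfl | rfl⟩
        · rw [Nat.mul_div_cancel_left _ two_pos] at hp ⊢
          split_ifs at hp with hc
          · rw [hp]
            exact ⟨hc.1, (hc.2.resolve_left h0).le⟩
          · rw [hp]
            exact ⟨h0, le_rfl⟩
        · have : (2 * m + 1) / 2 = m := by omega
          rw [this] at hp ⊢
          split_ifs at hp with hc
          · rw [hp]
            exact ⟨h0, le_rfl⟩
          · rw [hp]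
            push Not at hc
            exact hc h0
      obtain ⟨hr, hle⟩ := ih (j / 2) (by omega) (by omega) (by omega) key_le.1
      exact ⟨hr, hle.trans key_le.2⟩

theorem Tournament.root_le_key {n : ℕ} {key : ℕ → ℝ} {S : ℕ → Prop} {τ : ℕ → ℕ}
    (h : Tournament n key S τ) {i : ℕ} (hi : i < n) (hS : S i) :
    τ 1 ≠ 0 ∧ key (τ 1 - 1) ≤ key i := by
  have hl := (h.leaf i hi).1 hS
  have := h.root_le (j := n + i) (by omega) (by omega) (by omega)
  rwa [hl, Nat.add_sub_cancel] at this

/-! ### Memory layout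

Integer arrays: `0` number `n` of rows, `1` number `K` of columns, `2` demands `π`, `3` output,
`4` column of each row (`K` if the row is not assigned yet), `5` number of rows of each column,
`6` table of `j ↦ j / 2`, `7` table of `i ↦ i K`, `8` table of the base addresses of the trees,
`9` the tournament trees of all ordered pairs of columns, `13` marks of the visited columns,
`14` the row that realizes the label of each column; scalars: `10` current row, `11` column counter,
`12` selected column, `15` current column, `16` moved row, `17` its old column, `18` tree, `19` node,
`20` base address, `21` root value, `22` leaf value.
Real arrays: `0` costs, `2` column potentials, `3` labels; scalar: `4` distance. -/

/-- The read-only data: costs, and the tables of halves and addresses. -/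
structure Tables (n K : ℕ) (c : ℕ → ℕ → ℝ) (s : State) : Prop where
  rows : s.int 0 0 = n
  cols : s.int 1 0 = K
  half : ∀ j < 2 * n, s.int 6 j = j / 2
  cost : ∀ r l, s.real 0 (s.int 7 r + l) = c r l
  base : ∀ k < K, ∀ l < K, s.int 8 (s.int 7 k + l) = (k * K + l) * (2 * n)

theorem Tables.frame {n K : ℕ} {c : ℕ → ℕ → ℝ} {s s' : State} {I R : List ℕ}
    (h : Tables n K c s) (f : Frame I R s s') (hI : ∀ a ∈ [0, 1, 6, 7, 8], a ∉ I := by decide)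
    (hR : 0 ∉ R := by decide) : Tables n K c s' := by
  have h0 := f.int (hI 0 (by decide))
  have h1 := f.int (hI 1 (by decide))
  have h6 := f.int (hI 6 (by decide))
  have h7 := f.int (hI 7 (by decide))
  have h8 := f.int (hI 8 (by decide))
  have hr := f.real hR
  exact ⟨by rw [h0, h.rows], by rw [h1, h.cols], by rw [h6]; exact h.half,
    by rw [h7, hr]; exact h.cost, by rw [h7, h8]; exact h.base⟩

/-- Difference of the costs in the columns in cells `11` and `18` of the row before `e`. -/
abbrev keyExpr (e : IExpr) : RExpr :=
  .sub (.get 0 (.add (.get 7 (.sub e (.const 1))) (.var 11)))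
    (.get 0 (.add (.get 7 (.sub e (.const 1))) (.var 18)))

/-- Recompute the current node from its children and go to its parent. -/
def fixNode : Prog :=
  .seq (.iset 9 (.add (.var 20) (.var 19)) (.get 9 (.add (.var 20) (.add (.var 19) (.var 19)))))
  (.seq (.cond (.and
      (.ilt (.const 0) (.get 9 (.add (.var 20) (.add (.add (.var 19) (.var 19)) (.const 1)))))
      (.or (.not (.ilt (.const 0) (.get 9 (.add (.var 20) (.var 19)))))
        (.rlt (keyExpr (.get 9 (.add (.var 20) (.add (.add (.var 19) (.var 19)) (.const 1)))))
          (keyExpr (.get 9 (.add (.var 20) (.var 19)))))))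
    (.iset 9 (.add (.var 20) (.var 19))
      (.get 9 (.add (.var 20) (.add (.add (.var 19) (.var 19)) (.const 1)))))
    .skip)
  (.iset 19 (.const 0) (.get 6 (.var 19))))

theorem exec_fixNode (s : State) :
    fixNode.exec s = (s.setInt 9 (s.int 20 0 + s.int 19 0)
      (better (fun r => s.real 0 (s.int 7 r + s.int 11 0) - s.real 0 (s.int 7 r + s.int 18 0))
        (s.int 9 (s.int 20 0 + 2 * s.int 19 0))
        (s.int 9 (s.int 20 0 + (2 * s.int 19 0 + 1))))).setInt 19 0 (s.int 6 (s.int 19 0)) := by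
  -- The right child is read after the left one has been written into the node; its index `2 j + 1`
  -- is never `j`, so that write does not disturb it.
  have h1 : s.int 20 0 + (s.int 19 0 + s.int 19 0 + 1) ≠ s.int 20 0 + s.int 19 0 := by omega
  simp only [fixNode, Prog.exec, IExpr.eval, RExpr.eval, Test.Holds, better, two_mul]
  simp only [setInt_int_same, setInt_int_of_ne, setInt_real, ne_eq,
    Nat.reduceEqDiff, not_false_eq_true, Function.update_of_ne h1, Function.update_self,
    not_and_or, not_not, pos_iff_ne_zero]
  split_ifs <;> simp [setInt_setInt_same]

/-- The tournament tree of the ordered pair `(k, l)` of columns. -/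
def tree (n K : ℕ) (s : State) (k l : ℕ) : ℕ → ℕ := fun j => s.int 9 ((k * K + l) * (2 * n) + j)

/-- Select the tree, the leaf, and write the leaf. -/
def writeLeaf : Prog :=
  .seq (.iset 20 (.const 0) (.get 8 (.add (.get 7 (.var 18)) (.var 11))))
  (.seq (.iset 19 (.const 0) (.add (.var 0) (.var 16)))
  (.seq (.iset 9 (.add (.var 20) (.var 19)) (.var 22))
  (.iset 19 (.const 0) (.get 6 (.var 19)))))

/-- Write the value in cell `22` into the leaf of the row in cell `16` of the tree of the columns in
the cells `18` and `11`, and update the tree. -/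
def setLeaf : Prog := .seq writeLeaf (.loop (.ilt (.const 0) (.var 19)) fixNode)

/-- A change of one node can only violate the tournament equation of its parent. While climbing, all
nodes but the current one satisfy their equations, and the current index is below `2 ^ m`; halving
it lowers `m`, whence the logarithm. -/
theorem ends_setLeaf {n K : ℕ} {c : ℕ → ℕ → ℝ} {s : State} (hs : Tables n K c s) {k l r z : ℕ}
    (hk : k < K) (hl : l < K) (hr : r < n) (h18 : s.int 18 0 = k) (h11 : s.int 11 0 = l)
    (h16 : s.int 16 0 = r) (h22 : s.int 22 0 = z) (hz : z = r + 1 ∨ z = 0) {S : ℕ → Prop}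
    (ht : Tournament n (fun i => c i l - c i k) S (tree n K s k l)) :
    Ends setLeaf s (200 * (Nat.log 2 n + 1)) fun s' => Frame [9, 19, 20] [] s s' ∧
      (∀ x, (∀ j < 2 * n, x ≠ (k * K + l) * (2 * n) + j) → s'.int 9 x = s.int 9 x) ∧
      Tournament n (fun i => c i l - c i k) (fun i => if i = r then z ≠ 0 else S i)
        (tree n K s' k l) := by
  obtain ⟨B, hB⟩ : ∃ B, (k * K + l) * (2 * n) = B := ⟨_, rfl⟩
  have htree : ∀ t, tree n K t k l = fun j => t.int 9 (B + j) := fun t => by rw [← hB]; rfl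
  simp only [htree, hB] at ht ⊢
  refine (Ends.seq (Ends.straight (by simp [writeLeaf, Prog.Straight]) ?_) fun s' hs' =>
    Ends.loop (T := fixNode.steps) (fun m s' => Frame [9, 19, 20] [] s s' ∧
      (∀ x, (∀ j < 2 * n, x ≠ B + j) → s'.int 9 x = s.int 9 x) ∧ s'.int 20 0 = B ∧
      s'.int 19 0 < n ∧ s'.int 19 0 < 2 ^ m ∧
      (∀ i < n, s'.int 9 (B + (n + i)) = if i = r then z else s.int 9 (B + (n + i))) ∧
      (∀ j, 1 ≤ j → j < n → j ≠ s'.int 19 0 → s'.int 9 (B + j) =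
        better (fun i => c i l - c i k) (s'.int 9 (B + 2 * j)) (s'.int 9 (B + (2 * j + 1)))))
      (m := Nat.log 2 n + 1) ?_ ?_ hs').weaken
    (T' := 200 * (Nat.log 2 n + 1)) ?_
  · have e20 : s.int 8 (s.int 7 k + l) = B := by rw [hs.base k hk l hl, hB]
    have hlog := Nat.lt_pow_succ_log_self one_lt_two n
    simp only [writeLeaf, Prog.exec, IExpr.eval]
    simp [h18, h11, h16, h22, e20, hs.rows, hs.half (n + r) (by omega)]
    refine ⟨?_, ?_, by omega, by omega, ?_, ?_⟩
    · exact ((((Frame.refl _ _ s).setInt (by simp) _ _).setInt (by simp) _ _).setInt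
        (by simp) _ _).setInt (by simp) _ _
    · intro x hx
      exact Function.update_of_ne (hx (n + r) (by omega)) _ _
    · intro i hi
      by_cases hir : i = r
      · simp [hir]
      · rw [Function.update_of_ne (by omega), if_neg hir]
    · intro j h1 hj hjr
      rw [Function.update_of_ne (by omega), Function.update_of_ne (by omega),
        Function.update_of_ne (by omega)]
      exact ht.node j h1 hj
  · rintro m t ⟨hf, hout, h20, hn, hm, hleaf, hnode⟩ hpos
    replace hpos : 0 < t.int 19 0 := hpos
    obtain ⟨j, hj⟩ : ∃ j, t.int 19 0 = j := ⟨_, rfl⟩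
    rw [hj] at hpos hn hm hnode
    have ht' : Tables n K c t := hs.frame hf
    have hm0 : m ≠ 0 := by rintro rfl; omega
    obtain ⟨m, rfl⟩ := Nat.exists_eq_succ_of_ne_zero hm0
    refine Ends.straight (by simp [fixNode, Prog.Straight]) ⟨m, by omega, ?_⟩
    have e11 : t.int 11 0 = l := by rw [hf.int (by decide), h11]
    have e18 : t.int 18 0 = k := by rw [hf.int (by decide), h18]
    rw [exec_fixNode]
    simp [hj, h20, e11, e18, ht'.cost, ht'.half j (by omega)]
    refine ⟨?_, ?_, by omega, by rw [pow_succ] at hm; omega, ?_, ?_⟩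
    · exact (hf.setInt (by simp) _ _).setInt (by simp) _ _
    · intro x hx
      rw [Function.update_of_ne (hx j (by omega)), hout x hx]
    · intro i hi
      rw [Function.update_of_ne (by omega), hleaf i hi]
    · intro p h1 hp hpj
      -- Since `p` differs from the new current node `j / 2`, neither child of `p` is `j`.
      rw [Function.update_of_ne (a := B + 2 * p) (by omega),
        Function.update_of_ne (a := B + (2 * p + 1)) (by omega)]
      by_cases hpj' : p = j
      · subst hpj'
        rw [Function.update_self]
      · rw [Function.update_of_ne (by omega)]
        exact hnode p h1 hp hpj'
  · rintro m t ⟨hf, hout, h20, hn, hm, hleaf, hnode⟩ hpos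
    replace hpos : ¬ 0 < t.int 19 0 := hpos
    refine ⟨hf, hout, fun i hi => ?_, fun j h1 hj => hnode j h1 hj (by omega)⟩
    rw [hleaf i hi]
    by_cases hir : i = r
    · simp [hir]; omega
    · simpa [hir] using ht.leaf i hi
  · simp only [Prog.steps, writeLeaf, fixNode, IExpr.cost, Test.cost, RExpr.cost, Test.or,
      IExpr.var]
    norm_num
    omega

/-! ### Moving a row to another column -/

/-- Mixed-radix digits are unique; hence writing into one tree leaves all others intact. -/
theorem tree_index_inj {n K k l k' l' j j' : ℕ} (hl : l < K) (hl' : l' < K) (hj : j < 2 * n)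
    (hj' : j' < 2 * n) (h : (k * K + l) * (2 * n) + j = (k' * K + l') * (2 * n) + j') :
    k = k' ∧ l = l' := by
  have h2 : 0 < 2 * n := by omega
  have h1 : k * K + l = k' * K + l' := by
    have := congrArg (· / (2 * n)) h
    simpa [Nat.add_div_of_dvd_right, Nat.mul_div_cancel _ h2, Nat.div_eq_of_lt hj,
      Nat.div_eq_of_lt hj'] using this
  have hK : 0 < K := by omega
  have hkk : k = k' := by
    have := congrArg (· / K) h1
    simpa [Nat.add_div_of_dvd_right, Nat.mul_div_cancel _ hK, Nat.div_eq_of_lt hl,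
      Nat.div_eq_of_lt hl'] using this
  subst hkk
  exact ⟨rfl, by omega⟩

/-- The trees of all pairs `(k, l)` of columns are tournament trees, with active sets `A k l`. -/
def TreesOf (n K : ℕ) (c : ℕ → ℕ → ℝ) (A : ℕ → ℕ → ℕ → Prop) (s : State) : Prop :=
  ∀ k < K, ∀ l < K, Tournament n (fun i => c i l - c i k) (A k l) (tree n K s k l)

/-- All tournament trees are right for the row assignment `a`. -/
abbrev Trees (n K : ℕ) (c : ℕ → ℕ → ℝ) (a : ℕ → ℕ) (s : State) : Prop :=
  TreesOf n K c (fun k _ i => a i = k) s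

theorem TreesOf.congr {n K : ℕ} {c : ℕ → ℕ → ℝ} {A A' : ℕ → ℕ → ℕ → Prop} {s s' : State}
    (h : TreesOf n K c A s) (hA : ∀ k < K, ∀ l < K, ∀ i < n, A k l i ↔ A' k l i)
    (hs : s'.int 9 = s.int 9) : TreesOf n K c A' s' := fun k hk l hl =>
  (h k hk l hl).congr (hA k hk l hl) fun j _ => by simp only [tree, hs]

theorem ends_setLeaf_trees {n K : ℕ} {c : ℕ → ℕ → ℝ} {s : State} (hs : Tables n K c s)
    {k l r z : ℕ} (hk : k < K) (hl : l < K) (hr : r < n) (h18 : s.int 18 0 = k)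
    (h11 : s.int 11 0 = l) (h16 : s.int 16 0 = r) (h22 : s.int 22 0 = z)
    (hz : z = r + 1 ∨ z = 0) {A : ℕ → ℕ → ℕ → Prop} (ht : TreesOf n K c A s) :
    Ends setLeaf s (200 * (Nat.log 2 n + 1)) fun s' => Frame [9, 19, 20] [] s s' ∧
      TreesOf n K c (fun k' l' i => if k' = k ∧ l' = l ∧ i = r then z ≠ 0 else A k' l' i) s' := by
  refine (ends_setLeaf hs hk hl hr h18 h11 h16 h22 hz (ht k hk l hl)).mono le_rfl ?_
  rintro s' ⟨hf, hout, htour⟩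
  refine ⟨hf, fun k' hk' l' hl' => ?_⟩
  by_cases hkl : k' = k ∧ l' = l
  · obtain ⟨rfl, rfl⟩ := hkl
    exact htour.congr (fun i _ => by simp) fun _ _ => rfl
  · refine (ht k' hk' l' hl').congr (fun i _ => ?_) fun j hj => ?_
    · beta_reduce
      rw [if_neg fun h => hkl ⟨h.1, h.2.1⟩]
    · exact hout _ fun j' hj' h => hkl (tree_index_inj hl' hl hj hj' h)

/-- Move the row in cell `16` from the column in cell `17` (if it is one) to the column in cell
`15`, in the trees with second column in cell `11`. -/
def moveInTrees : Prog :=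
  .seq (.cond (.ilt (.var 17) (.var 1))
      (.seq (.seq (.iset 18 (.const 0) (.var 17)) (.iset 22 (.const 0) (.const 0))) setLeaf) .skip)
  (.seq (.seq (.iset 18 (.const 0) (.var 15))
    (.iset 22 (.const 0) (.add (.var 16) (.const 1)))) setLeaf)

/-- Move the row in cell `16` from the column in cell `17` (if it is one) to the column in cell
`15`. -/
def moveRow : Prog := .seq (.forRange 11 (.var 1) moveInTrees) (.iset 4 (.var 16) (.var 15))

/-- The trees are converted one second column at a time, so the active sets depend on `l'`: those
with `l' < l` already follow the new assignment, the others still follow `a`. -/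
theorem ends_moveInTrees {n K : ℕ} {c : ℕ → ℕ → ℝ} {s : State} (hs : Tables n K c s) {l r t : ℕ}
    {a : ℕ → ℕ} (ht : t < K) (hl : l < K) (hr : r < n) (h11 : s.int 11 0 = l)
    (h16 : s.int 16 0 = r) (h15 : s.int 15 0 = t) (h17 : s.int 17 0 = a r)
    (hT : TreesOf n K c (fun k l' i => (if l' < l then Function.update a r t else a) i = k) s) :
    Ends moveInTrees s (500 * (Nat.log 2 n + 1)) fun s' => Frame [9, 18, 19, 20, 22] [] s s' ∧
      TreesOf n K c (fun k l' i => (if l' < l + 1 then Function.update a r t else a) i = k) s' := by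
  refine (Ends.seq (Q := fun s' => Frame [9, 18, 19, 20, 22] [] s s' ∧
      TreesOf n K c (fun k l' i => (if l' < l + 1 then Function.update a r t else a) i = k) s')
    (T' := 12 + 200 * (Nat.log 2 n + 1))
    -- Halfway, the row `r` is in no tree with second column `l`. If `r` was unassigned, this
    -- already holds and nothing has to be deleted.
    (R := fun s' => Frame [9, 18, 19, 20, 22] [] s s' ∧
      TreesOf n K c (fun k l' i => (if l' < l then Function.update a r t else a) i = k ∧
        ¬ (l' = l ∧ i = r)) s')
    (Ends.cond (T := 12 + 200 * (Nat.log 2 n + 1)) (fun hb => ?_) (fun hb => ?_)) ?_).weaken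
    (T' := 500 * (Nat.log 2 n + 1)) ?_
  · replace hb : s.int 17 0 < s.int 1 0 := hb
    rw [h17, hs.cols] at hb
    have hf : Frame [9, 18, 19, 20, 22] [] s ((s.setInt 18 0 (a r)).setInt 22 0 0) :=
      ((Frame.refl _ _ s).setInt (by simp) _ _).setInt (by simp) _ _
    refine ((Ends.straight (by simp [Prog.Straight]) (Q := fun s' =>
      s' = (s.setInt 18 0 (a r)).setInt 22 0 0) (by simp [Prog.exec, IExpr.eval, h17])).seq
      (T' := 200 * (Nat.log 2 n + 1)) ?_).weaken (by simp [Prog.steps, IExpr.cost])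
    rintro s' rfl
    refine (ends_setLeaf_trees (z := 0) (k := a r) (l := l) (r := r) (hs.frame hf) hb hl hr
      (by simp) (by simpa using h11) (by simpa using h16) (by simp) (Or.inr rfl)
      (hT.congr (fun _ _ _ _ _ _ => Iff.rfl) (by simp))).mono le_rfl ?_
    rintro s' ⟨hf', hT'⟩
    refine ⟨hf.trans (hf'.mono (by decide) (by decide)), hT'.congr (fun k hk l' hl' i hi => ?_) rfl⟩
    by_cases h : l' = l ∧ i = r
    · obtain ⟨rfl, rfl⟩ := h
      simp
      exact fun h1 h2 => h1 h2.symm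
    · simp [h]
  · replace hb : ¬ s.int 17 0 < s.int 1 0 := hb
    rw [h17, hs.cols] at hb
    refine (Ends.straight (p := .skip) trivial ?_).weaken
      (show Prog.steps .skip ≤ 12 + 200 * (Nat.log 2 n + 1) from ?_)
    · refine ⟨Frame.refl _ _ s, hT.congr (fun k hk l' hl' i hi => ?_) rfl⟩
      by_cases h : l' = l ∧ i = r
      · obtain ⟨rfl, rfl⟩ := h
        simp
        omega
      · simp [h]
    · simp [Prog.steps]; omega
  · rintro s₁ ⟨hf₁, hT₁⟩
    have hs₁ : Tables n K c s₁ := hs.frame hf₁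
    have e11 : s₁.int 11 0 = l := by rw [hf₁.int (by decide), h11]
    have e15 : s₁.int 15 0 = t := by rw [hf₁.int (by decide), h15]
    have e16 : s₁.int 16 0 = r := by rw [hf₁.int (by decide), h16]
    have hf : Frame [9, 18, 19, 20, 22] [] s₁ ((s₁.setInt 18 0 t).setInt 22 0 (r + 1)) :=
      ((Frame.refl _ _ s₁).setInt (by simp) _ _).setInt (by simp) _ _
    refine ((Ends.straight (by simp [Prog.Straight]) (Q := fun s' =>
      s' = (s₁.setInt 18 0 t).setInt 22 0 (r + 1)) (by simp [Prog.exec, IExpr.eval, e15, e16])).seq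
      (T' := 200 * (Nat.log 2 n + 1)) ?_).weaken (by simp [Prog.steps, IExpr.cost])
    rintro s' rfl
    refine (ends_setLeaf_trees (z := r + 1) (k := t) (l := l) (r := r) (hs₁.frame hf) ht hl hr
      (by simp) (by simpa using e11) (by simpa using e16) (by simp) (Or.inl rfl)
      (hT₁.congr (fun _ _ _ _ _ _ => Iff.rfl) (by simp))).mono le_rfl ?_
    rintro s' ⟨hf', hT'⟩
    refine ⟨hf₁.trans (hf.trans (hf'.mono (by decide) (by decide))),
      hT'.congr (fun k hk l' hl' i hi => ?_) rfl⟩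
    by_cases h : l' = l ∧ i = r
    · obtain ⟨rfl, rfl⟩ := h
      simp [eq_comm]
    · have h3 : ¬ (k = t ∧ l' = l ∧ i = r) := fun h' => h h'.2
      rw [if_neg h3]
      simp only [h, not_false_eq_true, and_true]
      by_cases hl'' : l' < l
      · rw [if_pos hl'', if_pos (by omega)]
      · by_cases hll : l' = l
        · have hir : i ≠ r := fun h' => h ⟨hll, h'⟩
          rw [if_neg hl'', if_pos (by omega), Function.update_of_ne hir]
        · rw [if_neg hl'', if_neg (by omega)]
  · simp only [Test.cost, IExpr.cost]
    omega

theorem ends_moveRow {n K : ℕ} {c : ℕ → ℕ → ℝ} {s : State} (hs : Tables n K c s) {r t : ℕ}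
    (ht : t < K) (hr : r < n) (h16 : s.int 16 0 = r) (h15 : s.int 15 0 = t)
    (h17 : s.int 17 0 = s.int 4 r) (hT : Trees n K c (s.int 4) s) :
    Ends moveRow s (600 * (K * (Nat.log 2 n + 1))) fun s' =>
      Frame [4, 9, 11, 18, 19, 20, 22] [] s s' ∧ s'.int 4 = Function.update (s.int 4) r t ∧
      Trees n K c (s'.int 4) s' := by
  refine ((Ends.forRange (N := K) (T := 500 * (Nat.log 2 n + 1))
    (fun l s' => Frame [9, 11, 18, 19, 20, 22] [] s s' ∧ s'.int 11 0 = l ∧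
      TreesOf n K c (fun k l' i =>
        (if l' < l then Function.update (s.int 4) r t else s.int 4) i = k) s')
    ?_ ?_ ?_ ?_).seq fun s' hs' =>
    Ends.straight (p := .iset 4 (.var 16) (.var 15)) trivial ?_).weaken ?_
  · rintro j s' ⟨hf, -, -⟩
    simp [IExpr.eval, hf.int (a := 1) (by decide), hs.cols]
  · exact fun j s' h => h.2.1
  · exact ⟨(Frame.refl _ _ s).setInt (by decide) _ _, by simp,
      hT.congr (fun _ _ _ _ _ _ => by simp) (by simp)⟩
  · rintro l s' hl ⟨hf, h11, hT'⟩
    refine (ends_moveInTrees (hs.frame hf) ht hl hr h11 (by rw [hf.int (by decide), h16])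
      (by rw [hf.int (by decide), h15]) (by rw [hf.int (by decide), h17]) hT').mono le_rfl ?_
    rintro s'' ⟨hf', hT''⟩
    exact ⟨by rw [hf'.int (by decide), h11],
      (hf.trans (hf'.mono (by decide) (by decide))).setInt (by decide) _ _, by simp,
      hT''.congr (fun _ _ _ _ _ _ => Iff.rfl) (by simp)⟩
  · obtain ⟨hf, h11, hT'⟩ := hs'
    have e15 : s'.int 15 0 = t := by rw [hf.int (by decide), h15]
    have e16 : s'.int 16 0 = r := by rw [hf.int (by decide), h16]
    have e4 : s'.int 4 = s.int 4 := hf.int (by decide)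
    simp only [Prog.exec, IExpr.eval, e15, e16]
    refine ⟨(hf.mono (by decide) (by decide)).setInt (by decide) _ _, by simp [e4],
      hT'.congr (fun k hk l hl i hi => by simp [hl, e4]) (by simp)⟩
  · simp only [Prog.steps, IExpr.cost]
    have h1 : K ≤ K * (Nat.log 2 n + 1) := Nat.le_mul_of_pos_right _ (by omega)
    rw [show K * (500 * (Nat.log 2 n + 1) + (1 + 1) + 9) = 500 * (K * (Nat.log 2 n + 1)) + 11 * K by
      ring]
    omega

/-! ### Shortest augmenting paths -/

/-- The potentials `v` certify that every row `r < n` with a column is in a best column. -/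
def DualFeasible (n K : ℕ) (c : ℕ → ℕ → ℝ) (a : ℕ → ℕ) (v : ℕ → ℝ) : Prop :=
  ∀ r < n, a r < K → ∀ q < K, c r (a r) - v (a r) ≤ c r q - v q

/-- The labels `x`, marks `vis` and predecessor rows `p` of a shortest path search from the
unassigned row `i`; `ρ` numbers the visited columns in the order of their visits, `N` is the number
of the next one. -/
structure Labels (n K i : ℕ) (c : ℕ → ℕ → ℝ) (π cnt a : ℕ → ℕ) (v x : ℕ → ℝ) (vis p ρ : ℕ → ℕ)
    (N : ℕ) : Prop where
  full : ∀ k < K, vis k ≠ 0 → π k ≤ cnt k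
  rank_lt : ∀ k < K, vis k ≠ 0 → ρ k < N
  rank_eq : ∀ k < K, vis k = 0 → ρ k = N
  mono : ∀ k < K, ∀ l < K, vis k ≠ 0 → vis l = 0 → x k - v k ≤ x l - v l
  source : ∀ l < K, x l ≤ c i l
  edge : ∀ r < n, a r < K → vis (a r) ≠ 0 → ∀ l < K, x l ≤ x (a r) + c r l - c r (a r)
  pred : ∀ l < K, (p l = i ∧ x l = c i l) ∨ (p l < n ∧ a (p l) < K ∧ vis (a (p l)) ≠ 0 ∧
    ρ (a (p l)) < ρ l ∧ x l = x (a (p l)) + c (p l) l - c (p l) (a (p l)))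

/-- `x'` and `p'` result from the labels `x` and predecessor rows `p` by relaxing the edges out of
the column `cur`. -/
structure Relaxed (n K : ℕ) (c : ℕ → ℕ → ℝ) (a : ℕ → ℕ) (x : ℕ → ℝ) (p : ℕ → ℕ) (cur : ℕ)
    (x' : ℕ → ℝ) (p' : ℕ → ℕ) : Prop where
  le : ∀ l < K, ∀ r < n, a r = cur → x' l ≤ x cur + c r l - c r cur
  eq_or : ∀ l < K, (x' l = x l ∧ p' l = p l) ∨
    (x' l < x l ∧ p' l < n ∧ a (p' l) = cur ∧ x' l = x cur + c (p' l) l - c (p' l) cur)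

/-- The column `cur` is an unvisited column of least distance. -/
structure Selected (K : ℕ) (v x : ℕ → ℝ) (vis : ℕ → ℕ) (cur : ℕ) : Prop where
  lt : cur < K
  unvisited : vis cur = 0
  min : ∀ l < K, vis l = 0 → x cur - v cur ≤ x l - v l

/-- One step of Dijkstra's algorithm, with distances `x l - v l`. Visited columns keep their labels
because reduced lengths are nonnegative. The column `cur` keeps the rank `N` and the columns still
unvisited get `N + 1`, so predecessors always have smaller rank and the predecessor structure has no
cycles. -/
theorem Labels.step {n K i : ℕ} {c : ℕ → ℕ → ℝ} {π cnt a : ℕ → ℕ} {v x : ℕ → ℝ}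
    {vis p ρ : ℕ → ℕ} {N cur : ℕ} (h : Labels n K i c π cnt a v x vis p ρ N)
    (hd : DualFeasible n K c a v) (hc : Selected K v x vis cur) (hfull : π cur ≤ cnt cur)
    {x' : ℕ → ℝ} {p' : ℕ → ℕ} (hr : Relaxed n K c a x p cur x' p') :
    Labels n K i c π cnt a v x' (Function.update vis cur 1) p'
      (fun k => if vis k = 0 ∧ k ≠ cur then N + 1 else ρ k) (N + 1) := by
  -- Dual feasibility of `r` in `cur`: the path through `cur` is no closer than `cur` itself.
  have hcand : ∀ l < K, ∀ r < n, a r = cur → x cur - v cur ≤ x cur + c r l - c r cur - v l := by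
    rintro l hl r hr' rfl
    have := hd r hr' hc.lt l hl
    linarith
  -- A strict improvement would put `k` closer than `cur`, but visited columns are at most as far as
  -- `cur`.
  have hold : ∀ k < K, vis k ≠ 0 ∨ k = cur → x' k = x k ∧ p' k = p k := by
    intro k hk hv
    rcases hr.eq_or k hk with h1 | ⟨h1, h2, h3, h4⟩
    · exact h1
    · have h5 := hcand k hk _ h2 h3
      rcases hv with hv | rfl
      · have := h.mono k hk cur hc.lt hv hc.unvisited
        linarith
      · linarith
  have hvis : ∀ k, Function.update vis cur 1 k ≠ 0 ↔ vis k ≠ 0 ∨ k = cur := by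
    intro k
    by_cases hk : k = cur
    · simp [hk]
    · simp [hk]
  have hvis' : ∀ k, Function.update vis cur 1 k = 0 ↔ vis k = 0 ∧ k ≠ cur := by
    intro k
    have := not_congr (hvis k)
    push Not at this
    exact this
  refine ⟨fun k hk hv => ?_, fun k hk hv => ?_, fun k hk hv => ?_, fun k hk l hl hv hv' => ?_,
    fun l hl => ?_, fun r hrn har hv l hl => ?_, fun l hl => ?_⟩
  · rcases (hvis k).1 hv with hv | rfl
    · exact h.full k hk hv
    · exact hfull
  · have hv1 := (hvis k).1 hv
    rw [if_neg (by tauto)]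
    rcases hv1 with hv1 | rfl
    · exact (h.rank_lt k hk hv1).trans (Nat.lt_succ_self _)
    · rw [h.rank_eq k hk hc.unvisited]
      exact Nat.lt_succ_self _
  · rw [if_pos ((hvis' k).1 hv)]
  · have hv1 := (hvis k).1 hv
    have hv2 := (hvis' l).1 hv'
    rw [(hold k hk hv1).1]
    have hkc : x k - v k ≤ x cur - v cur := by
      rcases hv1 with hv1 | rfl
      · exact h.mono k hk cur hc.lt hv1 hc.unvisited
      · exact le_rfl
    rcases hr.eq_or l hl with h1 | ⟨h1, h2, h3, h4⟩
    · rw [h1.1]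
      exact hkc.trans (hc.min l hl hv2.1)
    · rw [h4]
      exact hkc.trans (hcand l hl _ h2 h3)
  · rcases hr.eq_or l hl with h1 | h1
    · rw [h1.1]
      exact h.source l hl
    · exact h1.1.le.trans (h.source l hl)
  · have hv1 := (hvis _).1 hv
    rw [(hold _ har hv1).1]
    rcases hv1 with hv1 | hv1
    · refine le_trans ?_ (h.edge r hrn har hv1 l hl)
      rcases hr.eq_or l hl with h1 | h1
      · exact h1.1.le
      · exact h1.1.le
    · have := hr.le l hl r hrn hv1
      rwa [← hv1] at this
  · rcases hr.eq_or l hl with ⟨h1, h2⟩ | ⟨h1, h2, h3, h4⟩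
    · rw [h1, h2]
      rcases h.pred l hl with h3 | ⟨h3, h4, h5, h6, h7⟩
      · exact Or.inl h3
      · refine Or.inr ⟨h3, h4, (hvis _).2 (Or.inl h5), ?_, ?_⟩
        · rw [if_neg (by tauto)]
          split_ifs
          · exact (h.rank_lt _ h4 h5).trans (Nat.lt_succ_self _)
          · exact h6
        · rw [(hold _ h4 (Or.inl h5)).1]
          exact h7
    · have hl' : vis l = 0 ∧ l ≠ cur := by
        by_contra hcon
        have := (hold l hl (by tauto)).1
        linarith
      refine Or.inr ⟨h2, by rw [h3]; exact hc.lt, by rw [h3]; simp, ?_, ?_⟩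
      · rw [h3, if_neg (by tauto), if_pos hl', h.rank_eq _ hc.lt hc.unvisited]
        exact Nat.lt_succ_self _
      · rw [h3, (hold cur hc.lt (Or.inr rfl)).1]
        exact h4

/-- The intermediate configuration in the augmentation along a shortest path that inserts the row
`i`: one more row has yet to enter the column `l`, or the augmentation is complete and `l = K`. -/
structure Moving (n K i : ℕ) (c : ℕ → ℕ → ℝ) (cnt a : ℕ → ℕ) (v : ℕ → ℝ) (p ρ : ℕ → ℕ) (l : ℕ) :
    Prop where
  row_lt : i < n
  le : l ≤ K
  before : ∀ r < i, a r < K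
  after : ∀ r < n, i < r → a r = K
  row : if l = K then a i < K else a i = K
  dual : DualFeasible n K c a v
  count : ∀ k < K, ((Finset.range n).filter (a · = k)).card + (if k = l then 1 else 0) = cnt k
  chain : ∀ m < K, m = l ∨ ρ m < ρ l → l < K →
    (p m = i ∧ ∀ q < K, c i m - v m ≤ c i q - v q) ∨
    (p m < n ∧ a (p m) < K ∧ ρ (a (p m)) < ρ m ∧
      c (p m) m - v m = c (p m) (a (p m)) - v (a (p m)))

/-- A correction term on either side avoids subtraction and covers `l = a r` as well as a row not
yet in a column. -/
theorem card_filter_update {n r l m : ℕ} {a : ℕ → ℕ} (hr : r < n) :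
    ((Finset.range n).filter (Function.update a r l · = m)).card + (if m = a r then 1 else 0) =
      ((Finset.range n).filter (a · = m)).card + (if m = l then 1 else 0) := by
  have hr' : r ∈ Finset.range n := Finset.mem_range.2 hr
  rw [Finset.card_filter, Finset.card_filter, ← Finset.add_sum_erase _ _ hr',
    ← Finset.add_sum_erase (Finset.range n) (fun j => if a j = m then 1 else 0) hr']
  have : ∑ j ∈ (Finset.range n).erase r, (if Function.update a r l j = m then 1 else 0) =
      ∑ j ∈ (Finset.range n).erase r, (if a j = m then 1 else 0) :=
    Finset.sum_congr rfl fun j hj => by rw [Function.update_of_ne (Finset.ne_of_mem_erase hj)]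
  simp only [this, Function.update_self, eq_comm (a := m)]
  omega

/-- The row `p l` is equally good in its old column and in `l`, so moving it keeps dual feasibility,
and the vacancy passes to the old column, of smaller rank. If `p l` is the new row `i`, it is best
in `l`, its old column is the marker `K`, and the augmentation is complete. -/
theorem Moving.step {n K i : ℕ} {c : ℕ → ℕ → ℝ} {cnt a : ℕ → ℕ} {v : ℕ → ℝ} {p ρ : ℕ → ℕ} {l : ℕ}
    (h : Moving n K i c cnt a v p ρ l) (hl : l < K) :
    p l < n ∧ Moving n K i c cnt (Function.update a (p l) l) v p ρ (a (p l)) ∧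
      (a (p l) = K ∨ (a (p l) < K ∧ ρ (a (p l)) < ρ l)) := by
  have hai : a i = K := by simpa [hl.ne] using h.row
  have hin := h.row_lt
  rcases h.chain l hl (Or.inl rfl) hl with ⟨hp, hq⟩ | ⟨hpn, hak, hρ, ht⟩
  · rw [hp, hai]
    refine ⟨hin, ⟨hin, le_rfl, fun r hr => ?_, fun r hr hir => ?_, by simpa, ?_, fun k hk => ?_,
      fun _ _ _ h => absurd h (lt_irrefl _)⟩, Or.inl rfl⟩
    · rw [Function.update_of_ne hr.ne]
      exact h.before r hr
    · rw [Function.update_of_ne hir.ne']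
      exact h.after r hr hir
    · intro r hr har q hqK
      by_cases hri : r = i
      · subst hri
        rw [Function.update_self]
        exact hq q hqK
      · rw [Function.update_of_ne hri] at har ⊢
        exact h.dual r hr har q hqK
    · have := card_filter_update (l := l) (m := k) (a := a) hin
      rw [hai] at this
      rw [this, h.count k hk]
  · have hpi : p l ≠ i := fun h' => by rw [h', hai] at hak; exact lt_irrefl _ hak
    refine ⟨hpn, ⟨hin, hak.le, fun r hr => ?_, fun r hr hir => ?_, ?_, ?_, fun k hk => ?_,
      fun m hm hml _ => ?_⟩, Or.inr ⟨hak, hρ⟩⟩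
    · by_cases hr' : r = p l
      · subst hr'
        rwa [Function.update_self]
      · rw [Function.update_of_ne hr']
        exact h.before r hr
    · by_cases hr' : r = p l
      · rw [← hr', h.after r hr hir] at hak
        exact absurd hak (lt_irrefl _)
      · rw [Function.update_of_ne hr']
        exact h.after r hr hir
    · rw [if_neg hak.ne, Function.update_of_ne hpi.symm, hai]
    · intro r hr har q hqK
      by_cases hr' : r = p l
      · subst hr'
        rw [Function.update_self, ht]
        exact h.dual _ hpn hak q hqK
      · rw [Function.update_of_ne hr'] at har ⊢
        exact h.dual r hr har q hqK
    · rw [card_filter_update hpn, h.count k hk]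
    · have hm' : ρ m ≤ ρ (a (p l)) := by
        rcases hml with rfl | hml
        · exact le_rfl
        · exact hml.le
      rcases h.chain m hm (Or.inr (by omega)) hl with h1 | ⟨h1, h2, h3, h4⟩
      · exact Or.inl h1
      · have hpm : p m ≠ p l := fun h' => by rw [h'] at h3; omega
        rw [Function.update_of_ne hpm]
        exact Or.inr ⟨h1, h2, h3, h4⟩

/-- The configuration after the insertion of the rows before `i`. -/
structure Partial (n K : ℕ) (c : ℕ → ℕ → ℝ) (π : ℕ → ℕ) (i : ℕ) (cnt a : ℕ → ℕ) (v : ℕ → ℝ) :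
    Prop where
  before : ∀ r < i, a r < K
  after : ∀ r < n, i ≤ r → a r = K
  dual : DualFeasible n K c a v
  count : ∀ k < K, ((Finset.range n).filter (a · = k)).card = cnt k
  cap : ∀ k < K, cnt k ≤ π k

theorem Partial.sum_count {n K : ℕ} {c : ℕ → ℕ → ℝ} {π : ℕ → ℕ} {i : ℕ} {cnt a : ℕ → ℕ}
    {v : ℕ → ℝ} (h : Partial n K c π i cnt a v) (hi : i ≤ n) :
    ∑ k ∈ Finset.range K, cnt k = i := by
  have h1 : ((Finset.range n).filter (a · < K)).card =
      ∑ k ∈ Finset.range K, (((Finset.range n).filter (a · < K)).filter (a · = k)).card :=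
    Finset.card_eq_sum_card_fiberwise fun r hr => by simpa using (Finset.mem_filter.1 hr).2
  have h2 : (Finset.range n).filter (a · < K) = Finset.range i := by
    ext r
    simp only [Finset.mem_filter, Finset.mem_range]
    refine ⟨fun ⟨hr, har⟩ => ?_, fun hr => ⟨by omega, h.before r hr⟩⟩
    by_contra hir
    rw [h.after r hr (by omega)] at har
    exact lt_irrefl _ har
  rw [h2, Finset.card_range] at h1
  rw [h1]
  refine Finset.sum_congr rfl fun k hk => ?_
  rw [← h.count k (Finset.mem_range.1 hk), ← h2, Finset.filter_filter]
  congr 1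
  ext r
  simp only [Finset.mem_filter, Finset.mem_range] at hk ⊢
  constructor
  · rintro ⟨hr, rfl⟩
    exact ⟨hr, hk, rfl⟩
  · rintro ⟨hr, -, h'⟩
    exact ⟨hr, h'⟩

/-- Only `i < n` rows are placed while the capacities add up to `n`. The column found here
guarantees that the search succeeds. -/
theorem Partial.exists_lt {n K : ℕ} {c : ℕ → ℕ → ℝ} {π : ℕ → ℕ} {i : ℕ} {cnt a : ℕ → ℕ}
    {v : ℕ → ℝ} (h : Partial n K c π i cnt a v) (hi : i < n)
    (hπ : ∑ k ∈ Finset.range K, π k = n) : ∃ k < K, cnt k < π k := by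
  by_contra! hcon
  have := Finset.sum_le_sum fun k hk => hcon k (Finset.mem_range.1 hk)
  rw [h.sum_count hi.le, hπ] at this
  omega

/-- With `D = x cur - v cur`, a visited column `l` has its potential changed by its distance minus
`D`, which is at most 0. Dual feasibility is checked by whether source and target are visited:
`edge` handles visited sources, `mono` and `min` compare with `D`. Predecessor edges among the
columns concerned become tight. -/
theorem Labels.moving {n K i : ℕ} {c : ℕ → ℕ → ℝ} {π cnt a : ℕ → ℕ} {v x : ℕ → ℝ}
    {vis p ρ : ℕ → ℕ} {N cur : ℕ} (h : Labels n K i c π cnt a v x vis p ρ N)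
    (hP : Partial n K c π i cnt a v) (hi : i < n) (hc : Selected K v x vis cur) {v' : ℕ → ℝ}
    (hv' : ∀ l < K, v' l = if vis l = 0 then v l else x l - (x cur - v cur)) :
    Moving n K i c (Function.update cnt cur (cnt cur + 1)) a v' p ρ cur := by
  -- The formula for visited columns also gives `v cur` at the unvisited `cur`; a rank below that of
  -- `cur`, which is `N`, means visited.
  have hcur : ∀ m < K, m = cur ∨ ρ m < ρ cur → v' m = x m - (x cur - v cur) := by
    rintro m hm (rfl | hρ)
    · rw [hv' m hm, if_pos hc.unvisited]
      ring
    · rw [hv' m hm, if_neg]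
      intro hvm
      rw [h.rank_eq m hm hvm, h.rank_eq cur hc.lt hc.unvisited] at hρ
      exact lt_irrefl _ hρ
  refine ⟨hi, hc.lt.le, hP.before, fun r hr hir => hP.after r hr hir.le, ?_, ?_, fun k hk => ?_,
    fun m hm hmc _ => ?_⟩
  · rw [if_neg hc.lt.ne]
    exact hP.after i hi le_rfl
  · intro r hr har q hq
    rw [hv' _ har, hv' q hq]
    have hd := hP.dual r hr har q hq
    split_ifs with h1 h2 h2
    · exact hd
    · have := h.mono q hq cur hc.lt h2 hc.unvisited
      linarith
    · have := h.edge r hr har h1 q hq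
      have := hc.min q hq h2
      linarith
    · have := h.edge r hr har h1 q hq
      linarith
  · by_cases hk' : k = cur
    · subst hk'
      rw [Function.update_self, hP.count k hk, if_pos rfl]
    · rw [Function.update_of_ne hk', hP.count k hk, if_neg hk', add_zero]
  · rw [hcur m hm hmc]
    rcases h.pred m hm with ⟨h1, h2⟩ | ⟨h1, h2, h3, h4, h5⟩
    · refine Or.inl ⟨h1, fun q hq => ?_⟩
      rw [hv' q hq, ← h2]
      have := h.source q hq
      split_ifs with h3
      · have := hc.min q hq h3
        linarith
      · linarith
    · refine Or.inr ⟨h1, h2, h4, ?_⟩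
      rw [hv' _ h2, if_neg h3, h5]
      ring

theorem Moving.partial {n K i : ℕ} {c : ℕ → ℕ → ℝ} {π cnt a : ℕ → ℕ} {v : ℕ → ℝ} {p ρ : ℕ → ℕ}
    (h : Moving n K i c cnt a v p ρ K) (hcap : ∀ k < K, cnt k ≤ π k) :
    Partial n K c π (i + 1) cnt a v := by
  refine ⟨fun r hr => ?_, fun r hr hir => h.after r hr hir, h.dual, fun k hk => ?_, hcap⟩
  · rcases Nat.lt_succ_iff_lt_or_eq.1 hr with hr | rfl
    · exact h.before r hr
    · simpa using h.row
  · simpa [hk.ne] using h.count k hk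

/-- Weak duality: an assignment with dual feasible potentials has least cost among the assignments
with the same column sizes. -/
theorem DualFeasible.cost_le {n K : ℕ} {c : ℕ → ℕ → ℝ} {a b : ℕ → ℕ} {v : ℕ → ℝ}
    (h : DualFeasible n K c a v) (ha : ∀ r < n, a r < K) (hb : ∀ r < n, b r < K)
    (hab : ∀ k < K, ((Finset.range n).filter (a · = k)).card =
      ((Finset.range n).filter (b · = k)).card) :
    ∑ r ∈ Finset.range n, c r (a r) ≤ ∑ r ∈ Finset.range n, c r (b r) := by
  -- Grouping rows by column shows that the total potential depends only on the column sizes.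
  have hsum : ∀ b : ℕ → ℕ, (∀ r < n, b r < K) → ∑ r ∈ Finset.range n, v (b r) =
      ∑ k ∈ Finset.range K, ((Finset.range n).filter (b · = k)).card • v k := by
    intro b hb
    rw [← Finset.sum_fiberwise_of_maps_to (s := Finset.range n) (t := Finset.range K) (g := b)
      fun r hr => Finset.mem_range.2 (hb r (Finset.mem_range.1 hr))]
    refine Finset.sum_congr rfl fun k _ => ?_
    rw [Finset.sum_congr rfl fun r hr => by rw [(Finset.mem_filter.1 hr).2], Finset.sum_const]
  have hv : ∑ r ∈ Finset.range n, v (a r) = ∑ r ∈ Finset.range n, v (b r) := by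
    rw [hsum a ha, hsum b hb]
    exact Finset.sum_congr rfl fun k hk => by rw [hab k (Finset.mem_range.1 hk)]
  have := Finset.sum_le_sum fun r hr => h r (Finset.mem_range.1 hr) (ha r (Finset.mem_range.1 hr))
    (b r) (hb r (Finset.mem_range.1 hr))
  rw [Finset.sum_sub_distrib, Finset.sum_sub_distrib, hv] at this
  linarith

/-! ### The program that inserts a row -/

/-- Initialize marks, labels and predecessor rows of the column in cell `11`. -/
def initLabel : Prog :=
  .seq (.iset 13 (.var 11) (.const 0))
  (.seq (.rset 3 (.var 11) (.get 0 (.add (.get 7 (.var 10)) (.var 11))))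
  (.iset 14 (.var 11) (.var 10)))

/-- Initialize marks, labels and predecessor rows. -/
def initLabels : Prog := .forRange 11 (.var 1) initLabel

theorem ends_initLabels {n K : ℕ} {c : ℕ → ℕ → ℝ} {s : State} (hs : Tables n K c s) {i : ℕ}
    (h10 : s.int 10 0 = i) :
    Ends initLabels s (50 * K + 50) fun s' => Frame [11, 13, 14] [3] s s' ∧
      ∀ l < K, s'.int 13 l = 0 ∧ s'.real 3 l = c i l ∧ s'.int 14 l = i := by
  refine ((Ends.forRange (N := K) (T := initLabel.steps)
    (fun l s' => Frame [11, 13, 14] [3] s s' ∧ s'.int 11 0 = l ∧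
      ∀ l' < l, s'.int 13 l' = 0 ∧ s'.real 3 l' = c i l' ∧ s'.int 14 l' = i) ?_ ?_ ?_ ?_).mono ?_
      fun s' h => ⟨h.1, h.2.2⟩)
  · rintro j s' ⟨hf, -, -⟩
    simp [IExpr.eval, hf.int (a := 1) (by decide), hs.cols]
  · exact fun j s' h => h.2.1
  · exact ⟨(Frame.refl _ _ s).setInt (by decide) _ _, by simp, by simp⟩
  · rintro l s' hl ⟨hf, h11, h⟩
    refine Ends.straight (by simp [initLabel, Prog.Straight]) ?_
    have e10 : s'.int 10 0 = i := by rw [hf.int (by decide), h10]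
    have hcost := (hs.frame hf).cost
    simp only [initLabel, Prog.exec, IExpr.eval, RExpr.eval]
    simp [h11, e10, hcost]
    refine ⟨(((hf.setInt (by simp) _ _).setReal (by simp) _ _).setInt (by simp) _ _).setInt
      (by simp) _ _, fun l' hl' => ?_⟩
    rcases Nat.lt_or_eq_of_le hl' with hl' | rfl
    · simpa [hl'.ne] using h l' hl'
    · simp
  · simp only [Prog.steps, initLabel, IExpr.cost, RExpr.cost, IExpr.var]
    omega

/-- Distance label of the column `e`. -/
abbrev distExpr (e : IExpr) : RExpr := .sub (.get 3 e) (.get 2 e)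

/-- Compare the column in cell `11` with the best one so far. -/
def selectStep : Prog :=
  .cond (.and (.not (.ilt (.const 0) (.get 13 (.var 11))))
    (.or (.not (.ilt (.var 12) (.var 1))) (.rlt (distExpr (.var 11)) (distExpr (.var 12)))))
    (.iset 12 (.const 0) (.var 11)) .skip

/-- Select an unvisited column of least distance. -/
def select : Prog :=
  .seq (.iset 12 (.const 0) (.var 1)) (.forRange 11 (.var 1) selectStep)

theorem ends_select {n K : ℕ} {c : ℕ → ℕ → ℝ} {s : State} (hs : Tables n K c s)
    (hex : ∃ l < K, s.int 13 l = 0) :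
    Ends select s (50 * K + 50) fun s' => Frame [11, 12] [] s s' ∧
      Selected K (s.real 2) (s.real 3) (s.int 13) (s'.int 12 0) := by
  refine ((Ends.straight (p := .iset 12 (.const 0) (.var 1)) trivial
    (Q := fun s' => s' = s.setInt 12 0 K) (by simp [Prog.exec, IExpr.eval, hs.cols])).seq
    (T' := K * (selectStep.steps + 11) + 8) (Q := fun s' => Frame [11, 12] [] s s' ∧
      Selected K (s.real 2) (s.real 3) (s.int 13) (s'.int 12 0)) ?_).weaken ?_
  · rintro _ rfl
    refine ((Ends.forRange (N := K) (T := selectStep.steps)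
      (fun l s' => Frame [11, 12] [] s s' ∧ s'.int 11 0 = l ∧
        -- The value `K` in cell `12` means that no unvisited column has been met so far.
        ((s'.int 12 0 = K ∧ ∀ l' < l, s.int 13 l' ≠ 0) ∨
          (s'.int 12 0 < K ∧ s.int 13 (s'.int 12 0) = 0 ∧ ∀ l' < l, s.int 13 l' = 0 →
            s.real 3 (s'.int 12 0) - s.real 2 (s'.int 12 0) ≤ s.real 3 l' - s.real 2 l')))
      ?_ ?_ ?_ ?_).mono ?_ ?_)
    · rintro j s' ⟨hf, -, -⟩
      simp [IExpr.eval, hf.int (a := 1) (by decide), hs.cols]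
    · exact fun j s' h => h.2.1
    · exact ⟨((Frame.refl _ _ s).setInt (by decide) _ _).setInt (by decide) _ _, by simp,
        by simp⟩
    · rintro l s' hl ⟨hf, h11, h⟩
      have e1 : s'.int 1 0 = K := (hs.frame hf).cols
      have e13 : s'.int 13 = s.int 13 := hf.int (by decide)
      have e2 : s'.real 2 = s.real 2 := hf.real (by decide)
      have e3 : s'.real 3 = s.real 3 := hf.real (by decide)
      refine Ends.straight (by simp [selectStep, Prog.Straight]) ?_
      simp only [selectStep, Prog.exec, IExpr.eval, RExpr.eval, Test.Holds, h11, e1, e13, e2, e3]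
      split_ifs with hc
      · refine ⟨by simpa using h11, (hf.setInt (by simp) _ _).setInt (by simp) _ _, by simp,
          Or.inr ?_⟩
        simp only [setInt_int_of_ne, ne_eq, Nat.reduceEqDiff, not_false_eq_true, setInt_int_same,
          Function.update_self]
        obtain ⟨hc1, hc2⟩ := hc
        refine ⟨hl, by omega, fun l' hl' hv => ?_⟩
        rcases Nat.lt_succ_iff_lt_or_eq.1 hl' with hl' | rfl
        · rcases h with ⟨h1, h2⟩ | ⟨h1, h2, h3⟩
          · exact absurd hv (h2 l' hl')
          · have := h3 l' hl' hv
            have hlt : s.real 3 l - s.real 2 l <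
                s.real 3 (s'.int 12 0) - s.real 2 (s'.int 12 0) := by
              by_contra hcon
              exact hc2 ⟨not_not.2 h1, hcon⟩
            linarith
        · exact le_rfl
      · refine ⟨h11, hf.setInt (by simp) _ _, by simp, ?_⟩
        simp only [setInt_int_of_ne, ne_eq, Nat.reduceEqDiff, not_false_eq_true]
        rcases h with ⟨h1, h2⟩ | ⟨h1, h2, h3⟩
        · refine Or.inl ⟨h1, fun l' hl' => ?_⟩
          rcases Nat.lt_succ_iff_lt_or_eq.1 hl' with hl' | rfl
          · exact h2 l' hl'
          · intro hv
            exact hc ⟨by omega, fun h => h.1 (by omega)⟩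
        · refine Or.inr ⟨h1, h2, fun l' hl' hv => ?_⟩
          rcases Nat.lt_succ_iff_lt_or_eq.1 hl' with hl' | rfl
          · exact h3 l' hl' hv
          · by_contra hcon
            exact hc ⟨by omega, fun h => h.2 (not_le.1 hcon)⟩
    · simp only [IExpr.cost]
      nlinarith
    · rintro s' ⟨hf, -, h⟩
      refine ⟨hf, ?_⟩
      rcases h with ⟨h1, h2⟩ | ⟨h1, h2, h3⟩
      · obtain ⟨l, hl, hv⟩ := hex
        exact absurd hv (h2 l hl)
      · exact ⟨h1, h2, h3⟩
  · simp only [Prog.steps, selectStep, IExpr.cost, RExpr.cost, Test.cost, IExpr.var]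
    norm_num
    omega

/-- The label of the column in cell `11` on the path via the selected column and the row before the
one in cell `21`. -/
abbrev candExpr : RExpr :=
  .sub (.add (.get 3 (.var 12)) (.get 0 (.add (.get 7 (.sub (.var 21) (.const 1))) (.var 11))))
    (.get 0 (.add (.get 7 (.sub (.var 21) (.const 1))) (.var 12)))

/-- Relax the edge from the selected column to the one in cell `11`. -/
def relaxStep : Prog :=
  .seq (.iset 21 (.const 0)
    (.get 9 (.add (.get 8 (.add (.get 7 (.var 12)) (.var 11))) (.const 1))))
  (.cond (.and (.ilt (.const 0) (.var 21)) (.rlt candExpr (.get 3 (.var 11))))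
    (.seq (.rset 3 (.var 11) candExpr) (.iset 14 (.var 11) (.sub (.var 21) (.const 1)))) .skip)

/-- Relax all edges from the selected column. -/
def relax : Prog := .forRange 11 (.var 1) relaxStep

/-- The root of the tree of `(cur, l)` is a best row for going from `cur` to `l`, so one comparison
relaxes all parallel edges. The label of `cur` is read in every pass and must not change meanwhile,
which is part of the invariant. -/
theorem ends_relax {n K : ℕ} {c : ℕ → ℕ → ℝ} {s : State} (hs : Tables n K c s) {cur : ℕ}
    (hn : 0 < n) (hcur : cur < K) (h12 : s.int 12 0 = cur) (hT : Trees n K c (s.int 4) s) :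
    Ends relax s (100 * K + 50) fun s' => Frame [11, 14, 21] [3] s s' ∧
      Relaxed n K c (s.int 4) (s.real 3) (s.int 14) cur (s'.real 3) (s'.int 14) := by
  refine ((Ends.forRange (N := K) (T := relaxStep.steps)
    (fun l s' => Frame [11, 14, 21] [3] s s' ∧ s'.int 11 0 = l ∧
      Relaxed n l c (s.int 4) (s.real 3) (s.int 14) cur (s'.real 3) (s'.int 14) ∧
      ∀ l', l' = cur ∨ l ≤ l' → s'.real 3 l' = s.real 3 l' ∧ s'.int 14 l' = s.int 14 l')
    ?_ ?_ ?_ ?_).mono ?_ fun s' h => ⟨h.1, h.2.2.1⟩)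
  · rintro j s' ⟨hf, -, -⟩
    simp [IExpr.eval, hf.int (a := 1) (by decide), hs.cols]
  · exact fun j s' h => h.2.1
  · exact ⟨(Frame.refl _ _ s).setInt (by decide) _ _, by simp, ⟨by simp, by simp⟩, by simp⟩
  · rintro l s' hl ⟨hf, h11, hR, hsame⟩
    have hs' := hs.frame hf
    have e12 : s'.int 12 0 = cur := by rw [hf.int (by decide), h12]
    have htour := hT cur hcur l hl
    obtain ⟨z, hz⟩ : ∃ z, tree n K s cur l 1 = z := ⟨_, rfl⟩
    have ez : s'.int 9 (s'.int 8 (s'.int 7 cur + l) + 1) = z := by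
      rw [hs'.base cur hcur l hl, hf.int (by decide)]
      exact hz
    have hact := htour.active le_rfl (show 1 < 2 * n by omega)
    have hroot := fun r hr => htour.root_le_key (i := r) hr
    rw [hz] at hact hroot
    have hx := (hsame l (Or.inr le_rfl)).1
    have hp := (hsame l (Or.inr le_rfl)).2
    have hxc := (hsame cur (Or.inl rfl)).1
    refine Ends.straight (by simp [relaxStep, Prog.Straight]) ?_
    simp only [relaxStep, Prog.exec, IExpr.eval, RExpr.eval, Test.Holds]
    simp only [setInt_int_same, setInt_int_of_ne, setInt_real, setReal_int, ne_eq,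
      Nat.reduceEqDiff, not_false_eq_true, Function.update_self, h11, e12, ez, hs'.cost, hx, hxc]
    split_ifs with hc
    · obtain ⟨hc1, hc2⟩ := hc
      obtain ⟨hz1, hz2⟩ := hact hc1.ne'
      -- Going from `cur` to itself has length 0 and fails the strict test.
      have hlc : l ≠ cur := by
        rintro rfl
        linarith
      refine ⟨by simp [h11], ?_, by simp, ⟨fun l' hl' r hr har => ?_, fun l' hl' => ?_⟩,
        fun l' hl' => ?_⟩
      · exact (((hf.setInt (by simp) _ _).setReal (by simp) _ _).setInt (by simp) _ _).setInt
          (by simp) _ _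
      · rcases Nat.lt_succ_iff_lt_or_eq.1 hl' with hl' | rfl
        · simpa [hl'.ne] using hR.le l' hl' r hr har
        · have := (hroot r hr har).2
          simp
          linarith
      · rcases Nat.lt_succ_iff_lt_or_eq.1 hl' with hl' | rfl
        · simpa [hl'.ne] using hR.eq_or l' hl'
        · right
          simp [hz1, hz2]
          linarith
      · have : l' ≠ l := by rintro rfl; omega
        simpa [this] using hsame l' (by omega)
    · refine ⟨by simp [h11], ?_, by simp, ⟨fun l' hl' r hr har => ?_, fun l' hl' => ?_⟩,
        fun l' hl' => ?_⟩
      · exact (hf.setInt (by simp) _ _).setInt (by simp) _ _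
      · rcases Nat.lt_succ_iff_lt_or_eq.1 hl' with hl' | rfl
        · simpa using hR.le l' hl' r hr har
        · obtain ⟨h1, h2⟩ := hroot r hr har
          have : ¬ (s.real 3 cur + c (z - 1) l' - c (z - 1) cur < s.real 3 l') := fun h =>
            hc ⟨Nat.pos_of_ne_zero h1, by linarith⟩
          simp [hx]
          linarith
      · rcases Nat.lt_succ_iff_lt_or_eq.1 hl' with hl' | rfl
        · simpa using hR.eq_or l' hl'
        · left
          simp [hx, hp]
      · simpa using hsame l' (by omega)
  · simp only [Prog.steps, relaxStep, IExpr.cost, RExpr.cost, Test.cost, IExpr.var]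
    norm_num
    omega

/-! ### The search loop -/

/-- Visit the selected column and select the next one. -/
def visit : Prog := .seq (.seq (.iset 13 (.var 12) (.const 1)) relax) select

/-- Search for a shortest path from the current row to a column with free capacity. -/
def search : Prog :=
  .seq select (.loop (.not (.ilt (.get 5 (.var 12)) (.get 2 (.var 12)))) visit)

/-- The labels stored in the memory. -/
abbrev LabelsAt (n K i : ℕ) (c : ℕ → ℕ → ℝ) (s : State) : (ℕ → ℕ) → ℕ → Prop :=
  Labels n K i c (s.int 2) (s.int 5) (s.int 4) (s.real 2) (s.real 3) (s.int 13) (s.int 14)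

/-- Visited columns are full, so a column with free capacity is unvisited. -/
theorem exists_unvisited {n K i : ℕ} {c : ℕ → ℕ → ℝ} {π cnt a : ℕ → ℕ} {v x : ℕ → ℝ}
    {vis p ρ : ℕ → ℕ} {N : ℕ} (h : Labels n K i c π cnt a v x vis p ρ N)
    (hex : ∃ k < K, cnt k < π k) : ∃ k < K, vis k = 0 := by
  obtain ⟨k, hk, hlt⟩ := hex
  refine ⟨k, hk, ?_⟩
  by_contra hv
  exact absurd (h.full k hk hv) (not_le.2 hlt)

theorem card_unvisited_update {K cur : ℕ} {vis : ℕ → ℕ} (hcur : cur < K) (hv : vis cur = 0) :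
    ((Finset.range K).filter (Function.update vis cur 1 · = 0)).card + 1 =
      ((Finset.range K).filter (vis · = 0)).card := by
  have : (Finset.range K).filter (Function.update vis cur 1 · = 0) =
      ((Finset.range K).filter (vis · = 0)).erase cur := by
    ext k
    by_cases hk : k = cur
    · simp [hk]
    · simp [hk]
  rw [this, Finset.card_erase_add_one]
  simp [hcur, hv]

theorem ends_visit {n K i : ℕ} {c : ℕ → ℕ → ℝ} {s : State} (hs : Tables n K c s) (hn : 0 < n)
    (hT : Trees n K c (s.int 4) s) (hd : DualFeasible n K c (s.int 4) (s.real 2))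
    (hex : ∃ k < K, s.int 5 k < s.int 2 k) {ρ : ℕ → ℕ} {N : ℕ} (hL : LabelsAt n K i c s ρ N)
    (hsel : Selected K (s.real 2) (s.real 3) (s.int 13) (s.int 12 0))
    (hfull : s.int 2 (s.int 12 0) ≤ s.int 5 (s.int 12 0)) :
    Ends visit s (200 * K + 200) fun s' => Frame [11, 12, 13, 14, 21] [3] s s' ∧
      s'.int 13 = Function.update (s.int 13) (s.int 12 0) 1 ∧
      (∃ ρ, LabelsAt n K i c s' ρ (N + 1)) ∧
      Selected K (s'.real 2) (s'.real 3) (s'.int 13) (s'.int 12 0) := by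
  have hf : Frame [11, 12, 13, 14, 21] [3] s (s.setInt 13 (s.int 12 0) 1) :=
    (Frame.refl _ _ s).setInt (by simp) _ _
  refine ((((Ends.straight (p := .iset 13 (.var 12) (.const 1)) trivial
    (Q := fun s' => s' = s.setInt 13 (s.int 12 0) 1) rfl).seq ?_).seq
    (R := fun s' => Frame [11, 12, 13, 14, 21] [3] s s' ∧
      s'.int 13 = Function.update (s.int 13) (s.int 12 0) 1 ∧
      ∃ ρ, LabelsAt n K i c s' ρ (N + 1)) (T' := 50 * K + 50) ?_).weaken
    (T' := 200 * K + 200) (T := Prog.steps (.iset 13 (.var 12) (.const 1)) + (100 * K + 50) +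
      (50 * K + 50)) ?_)
  · rintro _ rfl
    refine (ends_relax (hs.frame hf) hn hsel.lt (by simp)
      (hT.congr (fun _ _ _ _ _ _ => by simp) (by simp))).mono le_rfl ?_
    rintro s' ⟨hf', hR⟩
    have e13 : s'.int 13 = Function.update (s.int 13) (s.int 12 0) 1 := by
      rw [hf'.int (by decide), setInt_int_same]
    refine ⟨hf.trans (hf'.mono (by decide) (by decide)), e13,
      fun k => if s.int 13 k = 0 ∧ k ≠ s.int 12 0 then N + 1 else ρ k, ?_⟩
    rw [LabelsAt, hf'.int (a := 2) (by decide), hf'.int (a := 4) (by decide),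
      hf'.int (a := 5) (by decide), hf'.real (a := 2) (by decide), e13]
    exact hL.step hd hsel hfull (by simpa using hR)
  · rintro s₁ ⟨hf₁, e13, ρ', hL'⟩
    have hex' : ∃ k < K, s₁.int 5 k < s₁.int 2 k := by
      rw [hf₁.int (a := 2) (by decide), hf₁.int (a := 5) (by decide)]
      exact hex
    refine (ends_select (hs.frame hf₁) (exists_unvisited hL' hex')).mono le_rfl ?_
    rintro s' ⟨hf', hS⟩
    have f13 := hf'.int (a := 13) (by decide)
    refine ⟨hf₁.trans (hf'.mono (by decide) (by decide)), by rw [f13, e13], ⟨ρ', ?_⟩, ?_⟩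
    · rw [LabelsAt, hf'.int (a := 2) (by decide), hf'.int (a := 4) (by decide),
        hf'.int (a := 5) (by decide), hf'.real (a := 2) (by decide),
        hf'.real (a := 3) (by decide), f13, hf'.int (a := 14) (by decide)]
      exact hL'
    · rw [hf'.real (a := 2) (by decide), hf'.real (a := 3) (by decide), f13]
      exact hS
  · simp only [Prog.steps, IExpr.cost]
    omega

/-- The variant `m` is the number of unvisited columns. The invariant `N + m ≤ K` also bounds the
ranks by `K`, which later limits the length of the augmentation. -/
theorem ends_search {n K i : ℕ} {c : ℕ → ℕ → ℝ} {s : State} (hs : Tables n K c s) (hn : 0 < n)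
    (hT : Trees n K c (s.int 4) s) (hd : DualFeasible n K c (s.int 4) (s.real 2))
    (hex : ∃ k < K, s.int 5 k < s.int 2 k) {ρ : ℕ → ℕ} (hL : LabelsAt n K i c s ρ 0) :
    Ends search s (1000 * (K * K)) fun s' => Frame [11, 12, 13, 14, 21] [3] s s' ∧
      (∃ ρ N, N ≤ K ∧ LabelsAt n K i c s' ρ N) ∧
      Selected K (s'.real 2) (s'.real 3) (s'.int 13) (s'.int 12 0) ∧
      s'.int 5 (s'.int 12 0) < s'.int 2 (s'.int 12 0) := by
  have hK : 1 ≤ K := by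
    obtain ⟨k, hk, -⟩ := hex
    omega
  have hmle : ((Finset.range K).filter (s.int 13 · = 0)).card ≤ K :=
    (Finset.card_filter_le _ _).trans (Finset.card_range K).le
  refine ((ends_select hs (exists_unvisited hL hex)).seq (fun s₁ hs₁ =>
    Ends.loop (T := 200 * K + 200) (fun m s' => Frame [11, 12, 13, 14, 21] [3] s s' ∧
      (∃ ρ N, N + m ≤ K ∧ LabelsAt n K i c s' ρ N) ∧
      Selected K (s'.real 2) (s'.real 3) (s'.int 13) (s'.int 12 0) ∧
      ((Finset.range K).filter (s'.int 13 · = 0)).card = m)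
      (m := ((Finset.range K).filter (s.int 13 · = 0)).card) ?_ ?_ ?_)).weaken ?_
  · rintro m s' ⟨hf, ⟨ρ, N, hN, hL'⟩, hS, hm⟩ hb
    replace hb : ¬ (s'.int 5 (s'.int 12 0) < s'.int 2 (s'.int 12 0)) := hb
    have e2 := hf.int (a := 2) (by decide)
    have e4 := hf.int (a := 4) (by decide)
    have e5 := hf.int (a := 5) (by decide)
    have f2 := hf.real (a := 2) (by decide)
    have hT' : Trees n K c (s'.int 4) s' := by
      rw [e4]
      exact hT.congr (fun _ _ _ _ _ _ => Iff.rfl) (hf.int (by decide))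
    refine (ends_visit (hs.frame hf) hn hT' (by rw [e4, f2]; exact hd) (by rw [e2, e5]; exact hex) hL' hS
      (not_lt.1 hb)).mono le_rfl ?_
    rintro s'' ⟨hf', e13, ⟨ρ', hL''⟩, hS'⟩
    have hc := card_unvisited_update hS.lt hS.unvisited
    rw [← e13, hm] at hc
    exact ⟨m - 1, by omega, hf.trans hf', ⟨ρ', N + 1, by omega, hL''⟩, hS', by omega⟩
  · rintro m s' ⟨hf, ⟨ρ, N, hN, hL'⟩, hS, -⟩ hb
    replace hb : ¬ ¬ (s'.int 5 (s'.int 12 0) < s'.int 2 (s'.int 12 0)) := hb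
    exact ⟨hf, ⟨ρ, N, by omega, hL'⟩, hS, not_not.1 hb⟩
  · obtain ⟨hf, hS⟩ := hs₁
    refine ⟨hf.mono (by decide) (by decide), ⟨ρ, 0, by omega, ?_⟩, ?_, ?_⟩
    · rw [LabelsAt, hf.int (a := 2) (by decide), hf.int (a := 4) (by decide),
        hf.int (a := 5) (by decide), hf.real (a := 2) (by decide), hf.real (a := 3) (by decide),
        hf.int (a := 13) (by decide), hf.int (a := 14) (by decide)]
      exact hL
    · rw [hf.real (a := 2) (by decide), hf.real (a := 3) (by decide), hf.int (a := 13) (by decide)]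
      exact hS
    · rw [hf.int (a := 13) (by decide)]
  · simp only [Test.cost, IExpr.cost]
    have h1 := Nat.mul_le_mul_right (200 * K + 200 + (1 + 1 + 1 + (1 + 1 + 1) + 1 + 1)) hmle
    have h2 : K ≤ K * K := Nat.le_mul_of_pos_left _ hK
    nlinarith

/-! ### Dual update -/

/-- Change the potential of the column in cell `11` if it was visited. -/
def shiftPotential : Prog :=
  .cond (.ilt (.const 0) (.get 13 (.var 11)))
    (.rset 2 (.var 11) (.sub (.get 3 (.var 11)) (.get 4 (.const 0)))) .skip

/-- Change the potentials, and count the new row of the selected column. -/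
def shiftPotentials : Prog :=
  .seq (.rset 4 (.const 0) (distExpr (.var 12)))
  (.seq (.forRange 11 (.var 1) shiftPotential)
  (.iset 5 (.var 12) (.add (.get 5 (.var 12)) (.const 1))))

theorem ends_shiftPotentials {n K : ℕ} {c : ℕ → ℕ → ℝ} {s : State} (hs : Tables n K c s) {cur : ℕ}
    (h12 : s.int 12 0 = cur) :
    Ends shiftPotentials s (100 * K + 100) fun s' => Frame [5, 11] [2, 4] s s' ∧
      s'.int 5 = Function.update (s.int 5) cur (s.int 5 cur + 1) ∧
      ∀ l < K, s'.real 2 l = if s.int 13 l = 0 then s.real 2 l else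
        s.real 3 l - (s.real 3 cur - s.real 2 cur) := by
  refine ((Ends.straight (p := .rset 4 (.const 0) (distExpr (.var 12))) trivial
    (Q := fun s' => s' = s.setReal 4 0 (s.real 3 cur - s.real 2 cur))
    (by simp [Prog.exec, RExpr.eval, IExpr.eval, h12])).seq (fun s₁ hs₁ =>
    (Ends.forRange (N := K) (T := shiftPotential.steps)
    (fun l s' => Frame [11] [2, 4] s s' ∧ s'.int 11 0 = l ∧
      s'.real 4 0 = s.real 3 cur - s.real 2 cur ∧
      (∀ l' < l, s'.real 2 l' = if s.int 13 l' = 0 then s.real 2 l' else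
        s.real 3 l' - (s.real 3 cur - s.real 2 cur)) ∧
      ∀ l', l ≤ l' → s'.real 2 l' = s.real 2 l')
    ?_ ?_ ?_ ?_).seq (fun s' h => Ends.straight
      (p := .iset 5 (.var 12) (.add (.get 5 (.var 12)) (.const 1))) trivial ?_))).weaken ?_
  · rintro j s' ⟨hf, -, -⟩
    simp [IExpr.eval, hf.int (a := 1) (by decide), hs.cols]
  · exact fun j s' h => h.2.1
  · subst hs₁
    exact ⟨((Frame.refl _ _ s).setReal (by decide) _ _).setInt (by decide) _ _, by simp, by simp,
      by simp, by simp⟩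
  · rintro l s' hl ⟨hf, h11, h4, h, hrest⟩
    have e13 : s'.int 13 = s.int 13 := hf.int (by decide)
    have e3 : s'.real 3 = s.real 3 := hf.real (by decide)
    refine Ends.straight (by simp [shiftPotential, Prog.Straight]) ?_
    simp only [shiftPotential, Prog.exec, IExpr.eval, RExpr.eval, Test.Holds, h11, e13, e3, h4]
    split_ifs with hc
    · refine ⟨by simpa using h11, (hf.setReal (by simp) _ _).setInt (by simp) _ _, by simp,
        by simpa using h4, fun l' hl' => ?_, fun l' hl' => ?_⟩
      · rcases Nat.lt_succ_iff_lt_or_eq.1 hl' with hl' | rfl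
        · simpa [hl'.ne] using h l' hl'
        · simp [hc.ne']
      · have : l' ≠ l := by omega
        simpa [this] using hrest l' (by omega)
    · refine ⟨h11, hf.setInt (by simp) _ _, by simp,
        by simpa using h4, fun l' hl' => ?_, fun l' hl' => ?_⟩
      · rcases Nat.lt_succ_iff_lt_or_eq.1 hl' with hl' | rfl
        · simpa using h l' hl'
        · rw [if_pos (by omega)]
          simpa using hrest l' le_rfl
      · simpa using hrest l' (by omega)
  · obtain ⟨hf, -, -, h, -⟩ := h
    have e12 : s'.int 12 0 = cur := by rw [hf.int (by decide), h12]
    have e5 : s'.int 5 = s.int 5 := hf.int (by decide)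
    simp only [Prog.exec, IExpr.eval, e12, e5]
    exact ⟨(hf.mono (by decide) (by decide)).setInt (by simp) _ _, by simp [e5], by simpa using h⟩
  · simp only [Prog.steps, shiftPotential, IExpr.cost, RExpr.cost, Test.cost, IExpr.var]
    norm_num
    omega

/-! ### Augmentation along the path -/

/-- Move the row of the last edge of the path, and continue at its old column. -/
def augmentStep : Prog :=
  .seq (.seq (.iset 16 (.const 0) (.get 14 (.var 15))) (.iset 17 (.const 0) (.get 4 (.var 16))))
  (.seq moveRow (.iset 15 (.const 0) (.var 17)))

/-- Move the rows along the path that ends in the selected column. -/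
def augment : Prog :=
  .seq (.iset 15 (.const 0) (.var 12)) (.loop (.ilt (.var 15) (.var 1)) augmentStep)

theorem ends_augmentStep {n K i : ℕ} {c : ℕ → ℕ → ℝ} {s : State} (hs : Tables n K c s)
    (hT : Trees n K c (s.int 4) s) {cnt p ρ : ℕ → ℕ} {v : ℕ → ℝ} (h14 : s.int 14 = p)
    (hM : Moving n K i c cnt (s.int 4) v p ρ (s.int 15 0)) (hl : s.int 15 0 < K) :
    Ends augmentStep s (700 * (K * (Nat.log 2 n + 1))) fun s' =>
      Frame [4, 9, 11, 15, 16, 17, 18, 19, 20, 22] [] s s' ∧ Trees n K c (s'.int 4) s' ∧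
      Moving n K i c cnt (s'.int 4) v p ρ (s'.int 15 0) ∧
      (s'.int 15 0 = K ∨ (s'.int 15 0 < K ∧ ρ (s'.int 15 0) < ρ (s.int 15 0))) := by
  obtain ⟨l, h15⟩ : ∃ l, s.int 15 0 = l := ⟨_, rfl⟩
  rw [h15] at hM hl
  obtain ⟨hr, hM', hor⟩ := hM.step hl
  have hf : Frame [4, 9, 11, 15, 16, 17, 18, 19, 20, 22] [] s
      ((s.setInt 16 0 (p l)).setInt 17 0 (s.int 4 (p l))) :=
    ((Frame.refl _ _ s).setInt (by simp) _ _).setInt (by simp) _ _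
  refine ((Ends.straight (p := .seq (.iset 16 (.const 0) (.get 14 (.var 15)))
      (.iset 17 (.const 0) (.get 4 (.var 16)))) ⟨trivial, trivial⟩
    (Q := fun s' => s' = (s.setInt 16 0 (p l)).setInt 17 0 (s.int 4 (p l)))
    (by simp [Prog.exec, IExpr.eval, h14, h15])).seq
    (T' := 600 * (K * (Nat.log 2 n + 1)) + Prog.steps (.iset 15 (.const 0) (.var 17))) ?_).weaken ?_
  · rintro _ rfl
    refine (ends_moveRow (hs.frame hf) hl hr (by simp) (by simpa using h15) (by simp)
      (hT.congr (fun _ _ _ _ _ _ => by simp) (by simp))).seq ?_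
    rintro s₁ ⟨hf₁, h4, hT₁⟩
    have e17 : s₁.int 17 0 = s.int 4 (p l) := by rw [hf₁.int (by decide)]; simp
    have e4 : s₁.int 4 = Function.update (s.int 4) (p l) l := by simpa using h4
    refine Ends.straight trivial ?_
    simp only [Prog.exec, IExpr.eval, e17]
    refine ⟨(hf.trans (hf₁.mono (by decide) (by decide))).setInt (by simp) _ _,
      hT₁.congr (fun _ _ _ _ _ _ => by simp) (by simp), ?_, ?_⟩
    · simpa [e4] using hM'
    · simpa [h15] using hor
  · simp only [Prog.steps, IExpr.cost]
    have : 1 ≤ K * (Nat.log 2 n + 1) := Nat.mul_pos (by omega) (by omega)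
    omega

/-- The rank of the column with the vacancy decreases strictly, starting from at most `K`; hence
there are at most `K + 1` shifts. -/
theorem ends_augment {n K i : ℕ} {c : ℕ → ℕ → ℝ} {s : State} (hs : Tables n K c s)
    (hT : Trees n K c (s.int 4) s) {ρ : ℕ → ℕ}
    (hM : Moving n K i c (s.int 5) (s.int 4) (s.real 2) (s.int 14) ρ (s.int 12 0))
    (hl : s.int 12 0 < K) (hρ : ρ (s.int 12 0) ≤ K) :
    Ends augment s (2000 * (K * K * (Nat.log 2 n + 1))) fun s' =>
      Frame [4, 9, 11, 15, 16, 17, 18, 19, 20, 22] [] s s' ∧ Trees n K c (s'.int 4) s' ∧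
      Moving n K i c (s.int 5) (s'.int 4) (s.real 2) (s.int 14) ρ K := by
  refine ((Ends.straight (p := .iset 15 (.const 0) (.var 12)) trivial
    (Q := fun s' => s' = s.setInt 15 0 (s.int 12 0)) rfl).seq (fun s₁ hs₁ =>
    Ends.loop (T := 700 * (K * (Nat.log 2 n + 1)))
      (fun m s' => Frame [4, 9, 11, 15, 16, 17, 18, 19, 20, 22] [] s s' ∧
        Trees n K c (s'.int 4) s' ∧
        Moving n K i c (s.int 5) (s'.int 4) (s.real 2) (s.int 14) ρ (s'.int 15 0) ∧
        (s'.int 15 0 < K → ρ (s'.int 15 0) < m)) (m := K + 1) ?_ ?_ ?_)).weaken ?_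
  · rintro m s' ⟨hf, hT', hM', hm⟩ hb
    replace hb : s'.int 15 0 < s'.int 1 0 := hb
    rw [(hs.frame hf).cols] at hb
    refine (ends_augmentStep (hs.frame hf) hT' (hf.int (by decide)) hM' hb).mono le_rfl ?_
    rintro s'' ⟨hf', hT'', hM'', hor⟩
    have := hm hb
    exact ⟨m - 1, by omega, hf.trans hf', hT'', hM'', by omega⟩
  · rintro m s' ⟨hf, hT', hM', -⟩ hb
    replace hb : ¬ s'.int 15 0 < s'.int 1 0 := hb
    rw [(hs.frame hf).cols] at hb
    have : s'.int 15 0 = K := le_antisymm hM'.le (not_lt.1 hb)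
    rw [this] at hM'
    exact ⟨hf, hT', hM'⟩
  · subst hs₁
    exact ⟨(Frame.refl _ _ s).setInt (by simp) _ _,
      hT.congr (fun _ _ _ _ _ _ => by simp) (by simp), by simpa using hM, by simp; omega⟩
  · simp only [Prog.steps, Test.cost, IExpr.cost]
    have h1 : 1 ≤ K := by omega
    have h3 : 1 ≤ Nat.log 2 n + 1 := by omega
    have h2 : K * (Nat.log 2 n + 1) ≤ K * K * (Nat.log 2 n + 1) :=
      Nat.mul_le_mul_right _ (Nat.le_mul_of_pos_left _ h1)
    have h4 : K ≤ K * (Nat.log 2 n + 1) := Nat.le_mul_of_pos_right _ h3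
    rw [show (K + 1) * (700 * (K * (Nat.log 2 n + 1)) + (1 + 1 + (1 + 1) + 1)) =
      700 * (K * K * (Nat.log 2 n + 1)) + 700 * (K * (Nat.log 2 n + 1)) + 5 * K + 5 by ring]
    omega

/-- Insert the row in cell `10` along a shortest path. -/
def insertRow : Prog := .seq initLabels (.seq search (.seq shiftPotentials augment))

theorem ends_insertRow {n K i : ℕ} {c : ℕ → ℕ → ℝ} {s : State} (hs : Tables n K c s) (hi : i < n)
    (h10 : s.int 10 0 = i) (hT : Trees n K c (s.int 4) s)
    (hP : Partial n K c (s.int 2) i (s.int 5) (s.int 4) (s.real 2))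
    (hπ : ∑ k ∈ Finset.range K, s.int 2 k = n) :
    Ends insertRow s (4000 * (K * K * (Nat.log 2 n + 1))) fun s' =>
      Frame [4, 5, 9, 11, 12, 13, 14, 15, 16, 17, 18, 19, 20, 21, 22] [2, 3, 4] s s' ∧
      Trees n K c (s'.int 4) s' ∧
      Partial n K c (s.int 2) (i + 1) (s'.int 5) (s'.int 4) (s'.real 2) := by
  have hex := hP.exists_lt hi hπ
  have hK : 1 ≤ K := by
    obtain ⟨k, hk, -⟩ := hex
    omega
  refine ((ends_initLabels hs h10).seq (T' := 1000 * (K * K) +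
    ((100 * K + 100) + 2000 * (K * K * (Nat.log 2 n + 1)))) ?_).weaken ?_
  · rintro s₁ ⟨hf₁, hinit⟩
    have hs₁ := hs.frame hf₁
    have e2 := hf₁.int (a := 2) (by decide)
    have e4 := hf₁.int (a := 4) (by decide)
    have e5 := hf₁.int (a := 5) (by decide)
    have f2 := hf₁.real (a := 2) (by decide)
    have hT₁ : Trees n K c (s₁.int 4) s₁ := by
      rw [e4]; exact hT.congr (fun _ _ _ _ _ _ => Iff.rfl) (hf₁.int (by decide))
    have hP₁ : Partial n K c (s₁.int 2) i (s₁.int 5) (s₁.int 4) (s₁.real 2) := by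
      rwa [e2, e4, e5, f2]
    -- Nothing is visited yet: all ranks are 0, every label is the direct cost from row `i`, and the
    -- conditions on visited columns are vacuous.
    have hL₁ : LabelsAt n K i c s₁ (fun _ => 0) 0 :=
      ⟨fun k hk h => absurd (hinit k hk).1 h, fun k hk h => absurd (hinit k hk).1 h,
        fun _ _ _ => rfl, fun k hk _ _ h => absurd (hinit k hk).1 h,
        fun l hl => (hinit l hl).2.1.le, fun r _ hk h => absurd (hinit _ hk).1 h,
        fun l hl => Or.inl ⟨(hinit l hl).2.2, (hinit l hl).2.1⟩⟩
    refine (ends_search hs₁ (by omega) hT₁ hP₁.dual (by rwa [e2, e5]) hL₁).seq ?_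
    rintro s₂ ⟨hf₂, ⟨ρ, N, hN, hL₂⟩, hS₂, hlt⟩
    have hs₂ := hs₁.frame hf₂
    have hT₂ : Trees n K c (s₂.int 4) s₂ := by
      rw [hf₂.int (a := 4) (by decide)]
      exact hT₁.congr (fun _ _ _ _ _ _ => Iff.rfl) (hf₂.int (by decide))
    have hP₂ : Partial n K c (s₂.int 2) i (s₂.int 5) (s₂.int 4) (s₂.real 2) := by
      rwa [hf₂.int (a := 2) (by decide), hf₂.int (a := 4) (by decide),
        hf₂.int (a := 5) (by decide), hf₂.real (a := 2) (by decide)]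
    refine (ends_shiftPotentials hs₂ rfl).seq ?_
    rintro s₃ ⟨hf₃, hcnt, hv⟩
    have hs₃ := hs₂.frame hf₃
    have hT₃ : Trees n K c (s₃.int 4) s₃ := by
      rw [hf₃.int (a := 4) (by decide)]
      exact hT₂.congr (fun _ _ _ _ _ _ => Iff.rfl) (hf₃.int (by decide))
    have e12 : s₃.int 12 = s₂.int 12 := hf₃.int (by decide)
    have hM := hL₂.moving hP₂ hi hS₂ hv
    rw [← hcnt, ← hf₃.int (a := 4) (by decide), ← hf₃.int (a := 14) (by decide), ← e12] at hM
    -- The target column is unvisited, so its rank is `N ≤ K`.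
    have hρ : ρ (s₂.int 12 0) ≤ K := by
      rwa [hL₂.rank_eq _ hS₂.lt hS₂.unvisited]
    refine (ends_augment hs₃ hT₃ hM (by rw [e12]; exact hS₂.lt) (by rwa [e12])).mono le_rfl ?_
    rintro s₄ ⟨hf₄, hT₄, hM₄⟩
    refine ⟨((hf₁.mono (by decide) (by decide)).trans (hf₂.mono (by decide) (by decide))).trans
      ((hf₃.mono (by decide) (by decide)).trans (hf₄.mono (by decide) (by decide))), hT₄, ?_⟩
    rw [hf₄.int (a := 5) (by decide), hf₄.real (a := 2) (by decide)]
    refine hM₄.partial fun k hk => ?_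
    rw [hcnt, ← e2, ← hf₂.int (a := 2) (by decide)]
    by_cases hk' : k = s₂.int 12 0
    · rw [hk', Function.update_self]
      exact hlt
    · rw [Function.update_of_ne hk']
      exact hP₂.cap k hk
  · have h2 : K * K ≤ K * K * (Nat.log 2 n + 1) := Nat.le_mul_of_pos_right _ (by omega)
    have h4 : K ≤ K * K := Nat.le_mul_of_pos_left _ hK
    omega

/-! ### The program for the assignment problem -/

/-- Tabulate `j ↦ j / 2` for `j < 2 n`. -/
def halfTable : Prog :=
  .forRange 11 (.var 0) (.seq (.iset 6 (.add (.var 11) (.var 11)) (.var 11))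
    (.iset 6 (.add (.add (.var 11) (.var 11)) (.const 1)) (.var 11)))

theorem ends_halfTable {n : ℕ} {s : State} (h0 : s.int 0 0 = n) :
    Ends halfTable s (50 * n + 50) fun s' => Frame [6, 11] [] s s' ∧
      ∀ j < 2 * n, s'.int 6 j = j / 2 := by
  refine ((Ends.forRange (N := n) (T := 18)
    (fun l s' => Frame [6, 11] [] s s' ∧ s'.int 11 0 = l ∧ ∀ j < 2 * l, s'.int 6 j = j / 2)
    ?_ ?_ ?_ ?_).mono ?_ fun s' h => ⟨h.1, h.2.2⟩)
  · rintro j s' ⟨hf, -, -⟩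
    simp [IExpr.eval, hf.int (a := 0) (by decide), h0]
  · exact fun j s' h => h.2.1
  · exact ⟨(Frame.refl _ _ s).setInt (by decide) _ _, by simp, by simp⟩
  · rintro l s' hl ⟨hf, h11, h⟩
    refine (Ends.straight (by exact ⟨trivial, trivial⟩) ?_).weaken (le_refl 18)
    simp only [Prog.exec, IExpr.eval, setInt_int_of_ne, ne_eq, Nat.reduceEqDiff,
      not_false_eq_true, h11]
    refine ⟨by simp, ((hf.setInt (by simp) _ _).setInt (by simp) _ _).setInt (by simp) _ _,
      by simp, fun j hj => ?_⟩
    simp only [setInt_int_same]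
    by_cases h1 : j = l + l + 1
    · subst h1
      rw [Function.update_self]
      omega
    · rw [Function.update_of_ne h1]
      by_cases h2 : j = l + l
      · subst h2
        rw [Function.update_self]
        omega
      · rw [Function.update_of_ne h2]
        exact h j (by omega)
  · simp only [IExpr.cost]
    omega

/-- Tabulate multiples of the value of `d` in the integer array `t`, up to the multiplier `e`. -/
def multiples (t : ℕ) (e d : IExpr) : Prog :=
  .seq (.iset t (.const 0) (.const 0))
    (.forRange 11 e (.iset t (.add (.var 11) (.const 1)) (.add (.get t (.var 11)) d)))

/-- The machine cannot multiply, so multiples are accumulated by addition. The expressions `e` and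
`d` must not be affected by writes to the arrays `t` and `11`. -/
theorem ends_multiples {t N D : ℕ} {e d : IExpr} {s : State} (ht : t ≠ 11)
    (he : ∀ s', Frame [t, 11] [] s s' → e.eval s' = N)
    (hd : ∀ s', Frame [t, 11] [] s s' → d.eval s' = D) :
    Ends (multiples t e d) s (N * (e.cost + d.cost + 18) + e.cost + 9) fun s' =>
      Frame [t, 11] [] s s' ∧ ∀ j ≤ N, s'.int t j = j * D := by
  have hf0 : Frame [t, 11] [] s (s.setInt t 0 0) := (Frame.refl _ _ s).setInt (by simp) _ _
  refine ((Ends.straight (p := .iset t (.const 0) (.const 0)) trivial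
    (Q := fun s' => s' = s.setInt t 0 0) rfl).seq (fun s₁ hs₁ => Ends.forRange (N := N)
    (T := Prog.steps (.iset t (.add (.var 11) (.const 1)) (.add (.get t (.var 11)) d)))
    (fun l s' => Frame [t, 11] [] s s' ∧ s'.int 11 0 = l ∧ ∀ j ≤ l, s'.int t j = j * D)
    ?_ ?_ ?_ ?_)).mono ?_ fun s' h => ⟨h.1, h.2.2⟩
  · exact fun j s' h => he s' h.1
  · exact fun j s' h => h.2.1
  · subst hs₁
    refine ⟨hf0.setInt (by simp) _ _, by simp, fun j hj => ?_⟩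
    simp [ht, Nat.le_zero.1 hj]
  · rintro l s' hl ⟨hf, h11, h⟩
    refine Ends.straight trivial ?_
    simp only [Prog.exec, IExpr.eval, h11, hd s' hf]
    refine ⟨by simp [ht.symm, h11], (hf.setInt (by simp) _ _).setInt (by simp) _ _, by simp,
      fun j hj => ?_⟩
    rw [setInt_int_of_ne _ _ _ ht, setInt_int_same, h l le_rfl]
    by_cases h1 : j = l + 1
    · subst h1
      rw [Function.update_self]
      ring
    · rw [Function.update_of_ne h1]
      exact h j (by omega)
  · simp only [Prog.steps, IExpr.cost]
    rw [show N * (1 + 1 + 1 + 1 + (1 + 1 + 1 + d.cost + 1) + 1 + e.cost + 9) =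
      N * (e.cost + d.cost + 18) by ring]
    omega

/-- Tabulate `i ↦ i K` for `i ≤ n + K`. -/
def rowTable : Prog := multiples 7 (.add (.var 0) (.var 1)) (.var 1)

/-- The range up to `n + K` contains both `K` and `n`; the entries `K * K` and `n * K` there are the
loop bounds of `baseTable` and `negateCosts`. -/
theorem ends_rowTable {n K : ℕ} {s : State} (h0 : s.int 0 0 = n) (h1 : s.int 1 0 = K) :
    Ends rowTable s (50 * (n + K) + 50) fun s' => Frame [7, 11] [] s s' ∧
      ∀ j ≤ n + K, s'.int 7 j = j * K := by
  refine (ends_multiples (N := n + K) (D := K) (by decide) (fun s' hf => ?_) fun s' hf => ?_).weaken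
    ?_
  · simp [IExpr.eval, hf.int (a := 0) (by decide), hf.int (a := 1) (by decide), h0, h1]
  · simp [IExpr.eval, hf.int (a := 1) (by decide), h1]
  · simp only [IExpr.cost]
    omega

/-- Tabulate the base addresses of the trees. -/
def baseTable : Prog := multiples 8 (.get 7 (.var 1)) (.add (.var 0) (.var 0))

theorem ends_baseTable {n K : ℕ} {s : State} (h0 : s.int 0 0 = n) (h1 : s.int 1 0 = K)
    (h7 : s.int 7 K = K * K) :
    Ends baseTable s (50 * (K * K) + 50) fun s' => Frame [8, 11] [] s s' ∧
      ∀ j ≤ K * K, s'.int 8 j = j * (2 * n) := by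
  refine (ends_multiples (N := K * K) (D := 2 * n) (by decide) (fun s' hf => ?_)
    fun s' hf => ?_).weaken ?_
  · simp [IExpr.eval, hf.int (a := 7) (by decide), hf.int (a := 1) (by decide), h1, h7]
  · simp [IExpr.eval, hf.int (a := 0) (by decide), h0, two_mul]
  · simp only [IExpr.cost]
    omega

/-- Mark all rows as unassigned. -/
def clearRows : Prog := .forRange 11 (.var 0) (.iset 4 (.var 11) (.var 1))

theorem ends_clearRows {n K : ℕ} {s : State} (h0 : s.int 0 0 = n) (h1 : s.int 1 0 = K) :
    Ends clearRows s (50 * n + 50) fun s' => Frame [4, 11] [] s s' ∧ ∀ r < n, s'.int 4 r = K := by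
  refine ((Ends.forRange (N := n) (T := 5)
    (fun l s' => Frame [4, 11] [] s s' ∧ s'.int 11 0 = l ∧ ∀ r < l, s'.int 4 r = K)
    ?_ ?_ ?_ ?_).mono ?_ fun s' h => ⟨h.1, h.2.2⟩)
  · rintro j s' ⟨hf, -, -⟩
    simp [IExpr.eval, hf.int (a := 0) (by decide), h0]
  · exact fun j s' h => h.2.1
  · exact ⟨(Frame.refl _ _ s).setInt (by decide) _ _, by simp, by simp⟩
  · rintro l s' hl ⟨hf, h11, h⟩
    refine (Ends.straight (by exact trivial) ?_).weaken (le_refl 5)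
    have e1 : s'.int 1 0 = K := by rw [hf.int (by decide), h1]
    simp only [Prog.exec, IExpr.eval, h11, e1]
    refine ⟨by simpa using h11, (hf.setInt (by simp) _ _).setInt (by simp) _ _,
      by simp, fun r hr => ?_⟩
    rcases Nat.lt_succ_iff_lt_or_eq.1 hr with hr | rfl
    · simpa [hr.ne] using h r hr
    · simp
  · simp only [IExpr.cost]
    omega

/-- Set up the tables. -/
def setup : Prog := .seq halfTable (.seq rowTable (.seq baseTable clearRows))

theorem ends_setup {n K : ℕ} {s : State} (hK : 1 ≤ K) (h0 : s.int 0 0 = n) (h1 : s.int 1 0 = K) :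
    Ends setup s (200 * n + 500 * (K * K)) fun s' => Frame [4, 6, 7, 8, 11] [] s s' ∧
      Tables n K (fun r l => s'.real 0 (s'.int 7 r + l)) s' ∧
      (∀ j ≤ n + K, s'.int 7 j = j * K) ∧ ∀ r < n, s'.int 4 r = K := by
  refine ((ends_halfTable h0).seq (T' := (50 * (n + K) + 50) + ((50 * (K * K) + 50) +
    (50 * n + 50))) ?_).weaken ?_
  · rintro s₁ ⟨hf₁, h6⟩
    refine (ends_rowTable (n := n) (K := K) (by rw [hf₁.int (by decide), h0])
      (by rw [hf₁.int (by decide), h1])).seq ?_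
    rintro s₂ ⟨hf₂, h7⟩
    have g₂ : Frame [4, 6, 7, 8, 11] [] s s₂ :=
      (hf₁.mono (by decide) (by decide)).trans (hf₂.mono (by decide) (by decide))
    refine (ends_baseTable (n := n) (K := K) (by rw [g₂.int (by decide), h0])
      (by rw [g₂.int (by decide), h1]) (h7 K (by omega))).seq ?_
    rintro s₃ ⟨hf₃, h8⟩
    have g₃ := g₂.trans (hf₃.mono (I' := [4, 6, 7, 8, 11]) (R' := []) (by decide) (by decide))
    refine (ends_clearRows (n := n) (K := K) (by rw [g₃.int (by decide), h0])
      (by rw [g₃.int (by decide), h1])).mono le_rfl ?_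
    rintro s₄ ⟨hf₄, h4⟩
    have g₄ := g₃.trans (hf₄.mono (I' := [4, 6, 7, 8, 11]) (R' := []) (by decide) (by decide))
    have e7 : s₄.int 7 = s₂.int 7 := by rw [hf₄.int (by decide), hf₃.int (by decide)]
    -- The cost function is by definition what the memory returns, so `Tables.cost` holds for all
    -- `r` and `l` without range conditions.
    refine ⟨g₄, ⟨by rw [g₄.int (by decide), h0], by rw [g₄.int (by decide), h1], ?_,
      fun _ _ => rfl, fun k hk l hl => ?_⟩, by rwa [e7], h4⟩
    · rw [hf₄.int (by decide), hf₃.int (by decide), hf₂.int (by decide)]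
      exact h6
    · rw [e7, h7 k (by omega), hf₄.int (by decide)]
      refine h8 _ ?_
      have : (k + 1) * K ≤ K * K := Nat.mul_le_mul_right _ hk
      rw [Nat.succ_mul] at this
      omega
  · have : K ≤ K * K := Nat.le_mul_of_pos_left _ hK
    omega

/-- Insert all rows. -/
def insertRows : Prog := .forRange 10 (.var 0) insertRow

theorem ends_insertRows {n K : ℕ} {c : ℕ → ℕ → ℝ} {s : State} (hs : Tables n K c s)
    (hT : Trees n K c (s.int 4) s)
    (hP : Partial n K c (s.int 2) 0 (s.int 5) (s.int 4) (s.real 2))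
    (hπ : ∑ k ∈ Finset.range K, s.int 2 k = n) (hn : 0 < n) :
    Ends insertRows s (5000 * (K * K * n * (Nat.log 2 n + 1))) fun s' =>
      Frame [4, 5, 9, 10, 11, 12, 13, 14, 15, 16, 17, 18, 19, 20, 21, 22] [2, 3, 4] s s' ∧
      Partial n K c (s.int 2) n (s'.int 5) (s'.int 4) (s'.real 2) := by
  have hK : 1 ≤ K := by
    by_contra hK
    have : K = 0 := by omega
    subst this
    simp at hπ
    omega
  refine ((Ends.forRange (N := n) (T := 4000 * (K * K * (Nat.log 2 n + 1))) (fun i s' =>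
    Frame [4, 5, 9, 10, 11, 12, 13, 14, 15, 16, 17, 18, 19, 20, 21, 22] [2, 3, 4] s s' ∧
      s'.int 10 0 = i ∧ Trees n K c (s'.int 4) s' ∧
      Partial n K c (s.int 2) i (s'.int 5) (s'.int 4) (s'.real 2))
    ?_ ?_ ?_ ?_).mono ?_ fun s' h => ⟨h.1, h.2.2.2⟩)
  · rintro j s' ⟨hf, -, -⟩
    simp [IExpr.eval, hf.int (a := 0) (by decide), hs.rows]
  · exact fun j s' h => h.2.1
  · exact ⟨(Frame.refl _ _ s).setInt (by decide) _ _, by simp,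
      hT.congr (fun _ _ _ _ _ _ => by simp) (by simp), by simpa using hP⟩
  · rintro i s' hi ⟨hf, h10, hT', hP'⟩
    have e2 : s'.int 2 = s.int 2 := hf.int (by decide)
    refine (ends_insertRow (hs.frame hf) hi h10 hT' (by rwa [e2]) (by rwa [e2])).mono le_rfl ?_
    rintro s'' ⟨hf', hT'', hP''⟩
    rw [e2] at hP''
    exact ⟨by rw [hf'.int (by decide), h10],
      (hf.trans (hf'.mono (by decide) (by decide))).setInt (by simp) _ _, by simp,
      hT''.congr (fun _ _ _ _ _ _ => by simp) (by simp), by simpa using hP''⟩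
  · simp only [IExpr.cost]
    rw [show n * (4000 * (K * K * (Nat.log 2 n + 1)) + (1 + 1) + 9) =
      4000 * (K * K * n * (Nat.log 2 n + 1)) + 11 * n by ring]
    have : n ≤ K * K * n * (Nat.log 2 n + 1) := by
      calc n = 1 * 1 * n * 1 := by ring
        _ ≤ _ := by gcongr; omega
    omega

/-- Write the output matrix. -/
def writeOutput : Prog :=
  .forRange 11 (.var 0) (.iset 3 (.add (.get 7 (.var 11)) (.get 4 (.var 11))) (.const 1))

/-- Only the ones are written, since the output array starts at zero. -/
theorem ends_writeOutput {n K : ℕ} {s : State} (h0 : s.int 0 0 = n)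
    (h7 : ∀ i < n, s.int 7 i = i * K) (h4 : ∀ i < n, s.int 4 i < K) (h3 : ∀ j, s.int 3 j = 0) :
    Ends writeOutput s (50 * n + 50) fun s' =>
      ∀ i < n, ∀ k < K, s'.int 3 (i * K + k) = if s.int 4 i = k then 1 else 0 := by
  refine ((Ends.forRange (N := n) (T := 9)
    (fun l s' => Frame [3, 11] [] s s' ∧ s'.int 11 0 = l ∧
      ∀ i < n, ∀ k < K, s'.int 3 (i * K + k) = if i < l ∧ s.int 4 i = k then 1 else 0)
    ?_ ?_ ?_ ?_).mono ?_ fun s' h i hi k hk => ?_)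
  · rintro j s' ⟨hf, -, -⟩
    simp [IExpr.eval, hf.int (a := 0) (by decide), h0]
  · exact fun j s' h => h.2.1
  · exact ⟨(Frame.refl _ _ s).setInt (by decide) _ _, by simp, by simp [h3]⟩
  · rintro l s' hl ⟨hf, h11, h⟩
    refine (Ends.straight (by exact trivial) ?_).weaken (le_refl 9)
    have e7 : s'.int 7 l = l * K := by rw [hf.int (by decide), h7 l hl]
    have e4 : s'.int 4 l = s.int 4 l := by rw [hf.int (by decide)]
    simp only [Prog.exec, IExpr.eval, h11, e7, e4]
    refine ⟨by simpa using h11, (hf.setInt (by simp) _ _).setInt (by simp) _ _,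
      by simp, fun i hi k hk => ?_⟩
    simp only [setInt_int_of_ne, setInt_int_same, ne_eq, Nat.reduceEqDiff, not_false_eq_true]
    by_cases hik : i = l ∧ s.int 4 i = k
    · obtain ⟨rfl, rfl⟩ := hik
      simp
    · rw [Function.update_of_ne, h i hi k hk]
      · refine if_congr ?_ rfl rfl
        constructor
        · exact fun h => ⟨by omega, h.2⟩
        · exact fun h => ⟨lt_of_le_of_ne (Nat.lt_succ_iff.1 h.1) fun h' => hik ⟨h', h.2⟩, h.2⟩
      · intro heq
        have hK : 0 < K := by omega
        have h4l := h4 l hl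
        have hil : i = l := by
          have := congrArg (· / K) heq
          simpa [Nat.add_div_of_dvd_right, Nat.mul_div_cancel _ hK, Nat.div_eq_of_lt hk,
            Nat.div_eq_of_lt h4l] using this
        subst hil
        exact hik ⟨rfl, by omega⟩
  · simp only [IExpr.cost]
    omega
  · simpa [hi] using h.2.2 i hi k hk

/-- Solve the assignment problem. -/
def solve : Prog := .seq setup (.seq insertRows writeOutput)

/-- Zeros encode tournament trees with no active leaf, so zeroed memory needs no initialization. -/
theorem Trees.of_empty {n K : ℕ} {c : ℕ → ℕ → ℝ} {a : ℕ → ℕ} {s : State}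
    (ha : ∀ r < n, a r = K) (h9 : ∀ j, s.int 9 j = 0) : Trees n K c a s := by
  refine fun k hk l hl => ⟨fun i hi => ⟨fun h => ?_, fun _ => h9 _⟩, fun j h1 hj => ?_⟩
  · replace h : a i = k := h
    rw [ha i hi] at h
    exact absurd h hk.ne'
  · simp [tree, h9, better]

/-- With no row placed, dual feasibility is vacuous, so the initial potentials may be arbitrary. -/
theorem ends_solve {n K : ℕ} {s : State} (hn : 0 < n) (h0 : s.int 0 0 = n) (h1 : s.int 1 0 = K)
    (h3 : ∀ j, s.int 3 j = 0) (h5 : ∀ j, s.int 5 j = 0) (h9 : ∀ j, s.int 9 j = 0)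
    (hπ : ∑ k ∈ Finset.range K, s.int 2 k = n) :
    Ends solve s (6000 * (K * K * n * (Nat.log 2 n + 1))) fun s' => ∃ (a : ℕ → ℕ) (v : ℕ → ℝ),
      (∀ r < n, a r < K) ∧
      (∀ k < K, ((Finset.range n).filter (a · = k)).card = s.int 2 k) ∧
      DualFeasible n K (fun r l => s.real 0 (r * K + l)) a v ∧
      ∀ i < n, ∀ k < K, s'.int 3 (i * K + k) = if a i = k then 1 else 0 := by
  have hK : 1 ≤ K := by
    by_contra hK
    have : K = 0 := by omega
    subst this
    simp at hπ
    omega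
  refine ((ends_setup hK h0 h1).seq (T' := 5000 * (K * K * n * (Nat.log 2 n + 1)) +
    (50 * n + 50)) ?_).weaken ?_
  · rintro s₁ ⟨hf₁, hs₁, h7, h4⟩
    have e2 : s₁.int 2 = s.int 2 := hf₁.int (by decide)
    have e5 : s₁.int 5 = s.int 5 := hf₁.int (by decide)
    have e9 : s₁.int 9 = s.int 9 := hf₁.int (by decide)
    refine (ends_insertRows hs₁ (Trees.of_empty h4 (by rwa [e9])) ⟨by simp, fun r hr _ => h4 r hr,
      fun r hr har => absurd (h4 r hr) har.ne, fun k hk => ?_, fun k hk => ?_⟩ (by rwa [e2])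
      hn).seq ?_
    · rw [e5, h5, Finset.card_eq_zero, Finset.filter_eq_empty_iff]
      intro r hr
      rw [h4 r (Finset.mem_range.1 hr)]
      exact hk.ne'
    · rw [e5, h5]
      exact Nat.zero_le _
    rintro s₂ ⟨hf₂, hP⟩
    refine (ends_writeOutput (n := n) (K := K) ?_ ?_ (fun i hi => hP.before i hi) ?_).mono le_rfl ?_
    · rw [hf₂.int (by decide), hs₁.rows]
    · intro i hi
      rw [hf₂.int (by decide), h7 i (by omega)]
    · intro j
      rw [hf₂.int (by decide), hf₁.int (by decide), h3]
    intro s₃ h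
    refine ⟨s₂.int 4, s₂.real 2, fun r hr => hP.before r hr, fun k hk => ?_, fun r hr har q hq => ?_,
      h⟩
    -- The column sizes are at most `π` and have the same total `n`, hence equal `π`.
    · have hsum := hP.sum_count le_rfl
      rw [e2] at hP
      rw [← hπ] at hsum
      rw [hP.count k hk]
      exact (Finset.sum_eq_sum_iff_of_le fun k hk => hP.cap k (Finset.mem_range.1 hk)).1 hsum k
        (Finset.mem_range.2 hk)
    · have := hP.dual r hr har q hq
      simpa only [h7 r (by omega), hf₁.real (a := 0) (by decide)] using this
  · have h2 : n ≤ K * K * n * (Nat.log 2 n + 1) := by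
      calc n = 1 * 1 * n * 1 := by ring
        _ ≤ _ := by gcongr; omega
    have h3 : K * K ≤ K * K * n * (Nat.log 2 n + 1) := by
      calc K * K = K * K * 1 * 1 := by ring
        _ ≤ _ := by gcongr <;> omega
    omega

end RealRAM

/-! ### Assignments as functions -/

namespace MCAP

/-- The subgraph with the edges from `u_i` to `v_{b i}`. -/
def ofFun {n K : ℕ} (b : Fin n → Fin K) : BipSubgraph n K where
  verts := Set.univ
  Adj x y := (∃ i, x = Sum.inl i ∧ y = Sum.inr (b i)) ∨ ∃ i, y = Sum.inl i ∧ x = Sum.inr (b i)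
  adj_sub := by
    rintro x y (⟨i, rfl, rfl⟩ | ⟨i, rfl, rfl⟩) <;> simp
  edge_vert _ := Set.mem_univ _
  symm := ⟨fun _ _ h => h.symm⟩

@[simp] theorem ofFun_adj {n K : ℕ} (b : Fin n → Fin K) (i : Fin n) (k : Fin K) :
    (ofFun b).Adj (Sum.inl i) (Sum.inr k) ↔ b i = k := by
  simp [ofFun, eq_comm]

theorem biadjacency_ofFun {n K : ℕ} (b : Fin n → Fin K) (i : Fin n) (k : Fin K) :
    biadjacency (ofFun b) i k = if b i = k then 1 else 0 := by
  simp [biadjacency]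

theorem cost_ofFun {n K : ℕ} (C : Matrix (Fin n) (Fin K) ℝ) (b : Fin n → Fin K) :
    cost C (ofFun b) = ∑ i, C i (b i) := by
  simp [cost]

theorem biadjacency_ofFun_injective {n K : ℕ} :
    Function.Injective fun b : Fin n → Fin K => biadjacency (ofFun b) := by
  intro b b' h
  funext i
  have := congrFun (congrFun h i) (b' i)
  by_contra hne
  simp [biadjacency_ofFun, hne] at this

/-- Degree one at every `u_i` singles out one neighbour `v_{b i}`, and every edge of a bipartite
graph has a left end; the degree of `v_k` is then a fibre size. -/
theorem isAssignment_iff {n K : ℕ} {π : Fin K → ℕ} {G : BipSubgraph n K} :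
    IsAssignment π G ↔
      ∃ b : Fin n → Fin K, G = ofFun b ∧ ∀ k, (Finset.univ.filter (b · = k)).card = π k := by
  have hcol : ∀ (b : Fin n → Fin K) (k : Fin K), ((ofFun b).neighborSet (Sum.inr k)).ncard =
      (Finset.univ.filter (b · = k)).card := by
    intro b k
    have : (ofFun b).neighborSet (Sum.inr k) =
        Sum.inl '' ((Finset.univ.filter (b · = k) : Finset (Fin n)) : Set (Fin n)) := by
      ext x
      rcases x with i | l
      · rw [SimpleGraph.Subgraph.mem_neighborSet, SimpleGraph.Subgraph.adj_comm]
        simp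
      · simp [ofFun]
    rw [this, Set.ncard_image_of_injective _ Sum.inl_injective, Set.ncard_coe_finset]
  constructor
  · rintro ⟨hv, hrow, hcard⟩
    have hb : ∀ i, ∃ k, ∀ x, G.Adj (Sum.inl i) x ↔ x = Sum.inr k := by
      intro i
      obtain ⟨y, hy⟩ := Set.ncard_eq_one.1 (hrow i)
      have hmem : ∀ x, G.Adj (Sum.inl i) x ↔ x = y := fun x => by
        rw [← SimpleGraph.Subgraph.mem_neighborSet, hy, Set.mem_singleton_iff]
      have hadj := G.adj_sub ((hmem y).2 rfl)
      rcases y with j | k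
      · simp at hadj
      · exact ⟨k, hmem⟩
    choose b hb using hb
    have hG : G = ofFun b := by
      ext x y
      · simp [hv, ofFun]
      · rcases x with i | k
        · rw [hb]
          rcases y with j | l
          · simp [ofFun]
          · rw [ofFun_adj, Sum.inr.injEq, eq_comm]
        · rw [G.adj_comm, (ofFun b).adj_comm]
          rcases y with j | l
          · rw [hb, ofFun_adj, Sum.inr.injEq, eq_comm]
          · have h1 : ¬ G.Adj (Sum.inr l) (Sum.inr k) := fun h => by
              have := G.adj_sub h
              simp at this
            simp [h1, ofFun]
    refine ⟨b, hG, fun k => ?_⟩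
    rw [← hcol, ← hG, hcard]
  · rintro ⟨b, rfl, hb⟩
    refine ⟨rfl, fun i => ?_, fun k => by rw [hcol, hb]⟩
    rw [Set.ncard_eq_one]
    refine ⟨Sum.inr (b i), ?_⟩
    ext x
    simp [ofFun]

theorem injOn_biadjacency {n K : ℕ} (π : Fin K → ℕ) :
    Set.InjOn biadjacency {G : BipSubgraph n K | IsAssignment π G} := by
  intro G hG G' hG' h
  obtain ⟨b, rfl, -⟩ := isAssignment_iff.1 hG
  obtain ⟨b', rfl, -⟩ := isAssignment_iff.1 hG'
  rw [biadjacency_ofFun_injective h]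

/-- A zero-one row with sum 1 has exactly one entry 1, whose position defines the function. -/
theorem feasible_eq_image {n K : ℕ} (m : ℕ) :
    Clustering.feasible n K m =
      biadjacency '' {G : BipSubgraph n K | IsAssignment (fun _ => m) G} := by
  have hcol : ∀ (b : Fin n → Fin K) (k : Fin K), ∑ i, biadjacency (ofFun b) i k =
      ((Finset.univ.filter (b · = k)).card : ℝ) := by
    intro b k
    simp [biadjacency_ofFun]
  ext H
  constructor
  · rintro ⟨hrow, hcard, h01⟩
    have hb : ∀ i, ∃ k, ∀ l, H i l = if k = l then 1 else 0 := by
      intro i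
      have hsum : ∑ k, H i k = 1 := by
        have := congrFun hrow i
        simpa [Matrix.mulVec, dotProduct] using this
      have hind : ∀ k, H i k = if H i k = 1 then 1 else 0 := fun k => by
        rcases h01 i k with h | h <;> simp [h]
      rw [Finset.sum_congr rfl fun k _ => hind k, Finset.sum_boole] at hsum
      obtain ⟨k, hk⟩ := Finset.card_eq_one.1 (by exact_mod_cast hsum :
        (Finset.univ.filter (H i · = 1)).card = 1)
      refine ⟨k, fun l => ?_⟩
      rw [hind l]
      refine if_congr ?_ rfl rfl
      have : l ∈ Finset.univ.filter (H i · = 1) ↔ l ∈ ({k} : Finset (Fin K)) := by rw [hk]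
      simpa [eq_comm] using this
    choose b hb using hb
    have hH : biadjacency (ofFun b) = H := by
      ext i k
      rw [biadjacency_ofFun, hb]
    refine ⟨ofFun b, isAssignment_iff.2 ⟨b, rfl, fun k => ?_⟩, hH⟩
    have h1 := congrFun hcard k
    simp only [Matrix.mulVec, dotProduct, Matrix.transpose_apply, mul_one, ← hH, hcol] at h1
    exact_mod_cast h1
  · rintro ⟨G, hG, rfl⟩
    obtain ⟨b, rfl, hb⟩ := isAssignment_iff.1 hG
    refine ⟨?_, ?_, fun i k => ?_⟩
    · funext i
      simp [Matrix.mulVec, dotProduct, biadjacency_ofFun]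
    · funext k
      simp [Matrix.mulVec, dotProduct, hcol, hb]
    · rw [biadjacency_ofFun]
      split_ifs <;> simp

/-! ### Frobenius distance and cost -/

theorem frobNorm_le_iff {n K : ℕ} (A B : Matrix (Fin n) (Fin K) ℝ) :
    Clustering.frobNorm A ≤ Clustering.frobNorm B ↔
      ∑ i, ∑ k, A i k ^ 2 ≤ ∑ i, ∑ k, B i k ^ 2 := by
  have h : ∀ A : Matrix (Fin n) (Fin K) ℝ,
      Clustering.frobNorm A = (∑ i, ∑ k, A i k ^ 2) ^ (1 / 2 : ℝ) := fun A => by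
    simp [Clustering.frobNorm, Matrix.frobenius_norm_def]
  have h0 : ∀ A : Matrix (Fin n) (Fin K) ℝ, 0 ≤ ∑ i, ∑ k, A i k ^ 2 := fun A =>
    Finset.sum_nonneg fun i _ => Finset.sum_nonneg fun k _ => sq_nonneg _
  rw [h, h, Real.rpow_le_rpow_iff (h0 A) (h0 B) (by norm_num)]

/-- Row `i` contributes `∑ k, C i k ^ 2` plus `1 - 2 C i (b i)` from its single one; only the last
term depends on the assignment. -/
theorem sum_sq_biadjacency_sub {n K : ℕ} (C : Matrix (Fin n) (Fin K) ℝ) {π : Fin K → ℕ}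
    {G : BipSubgraph n K} (hG : IsAssignment π G) :
    ∑ i, ∑ k, (biadjacency G - C) i k ^ 2 = n + ∑ i, ∑ k, C i k ^ 2 + 2 * cost (-C) G := by
  obtain ⟨b, rfl, -⟩ := isAssignment_iff.1 hG
  have : ∀ i, ∑ k, (biadjacency (ofFun b) - C) i k ^ 2 =
      1 + ∑ k, C i k ^ 2 + 2 * (-C) i (b i) := by
    intro i
    have h1 : ∀ k, (biadjacency (ofFun b) - C) i k ^ 2 =
        (if b i = k then 1 - 2 * C i k else 0) + C i k ^ 2 := fun k => by
      rw [Matrix.sub_apply, biadjacency_ofFun]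
      split_ifs <;> ring
    rw [Finset.sum_congr rfl fun k _ => h1 k, Finset.sum_add_distrib, Finset.sum_ite_eq,
      if_pos (Finset.mem_univ _), Matrix.neg_apply]
    ring
  rw [Finset.sum_congr rfl fun i _ => this i, cost_ofFun, Finset.sum_add_distrib,
    Finset.sum_add_distrib, Finset.mul_sum]
  simp

theorem frobNorm_biadjacency_le_iff {n K : ℕ} (C : Matrix (Fin n) (Fin K) ℝ) {π π' : Fin K → ℕ}
    {G G' : BipSubgraph n K} (hG : IsAssignment π G) (hG' : IsAssignment π' G') :
    Clustering.frobNorm (biadjacency G - C) ≤ Clustering.frobNorm (biadjacency G' - C) ↔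
      cost (-C) G ≤ cost (-C) G' := by
  rw [frobNorm_le_iff, sum_sq_biadjacency_sub C hG, sum_sq_biadjacency_sub C hG']
  constructor <;> intro h <;> linarith

theorem proj_eq_image {n K : ℕ} (m : ℕ) (C : Matrix (Fin n) (Fin K) ℝ) :
    Clustering.proj m C =
      biadjacency '' {G : BipSubgraph n K | IsMinCostAssignment (-C) (fun _ => m) G} := by
  ext H
  constructor
  · rintro ⟨hH, hmin⟩
    rw [feasible_eq_image] at hH
    obtain ⟨G, hG, rfl⟩ := hH
    exact ⟨G, ⟨hG, fun G' hG' => (frobNorm_biadjacency_le_iff C hG hG').1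
      (hmin _ (by rw [feasible_eq_image]; exact ⟨G', hG', rfl⟩))⟩, rfl⟩
  · rintro ⟨G, ⟨hG, hmin⟩, rfl⟩
    refine ⟨by rw [feasible_eq_image]; exact ⟨G, hG, rfl⟩, fun H' hH' => ?_⟩
    rw [feasible_eq_image] at hH'
    obtain ⟨G', hG', rfl⟩ := hH'
    exact (frobNorm_biadjacency_le_iff C hG hG').2 (hmin G' hG')

end MCAP

/-! ### The running time -/

namespace RealRAM

/-- Compute the common column size, and store it as the demand of every column. -/
def equalDemands : Prog :=
  .seq (.loop (.ilt (.var 20) (.var 0)) (.seq (.iset 20 (.const 0) (.add (.var 20) (.var 1)))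
      (.iset 21 (.const 0) (.add (.var 21) (.const 1)))))
    (.forRange 11 (.var 1) (.iset 2 (.var 11) (.var 21)))

/-- Division by repeated addition: cell `20` holds `K` times cell `21` until it reaches `n`. As `K ≥
1`, this takes `m ≤ n` passes. -/
theorem ends_equalDemands {n K m : ℕ} {s : State} (hK : 1 ≤ K) (h0 : s.int 0 0 = n)
    (h1 : s.int 1 0 = K) (hm : n = K * m) (h20 : s.int 20 0 = 0) (h21 : s.int 21 0 = 0) :
    Ends equalDemands s (50 * n + 50 * K + 50) fun s' => Frame [2, 11, 20, 21] [] s s' ∧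
      ∀ k < K, s'.int 2 k = m := by
  refine (Ends.seq (Ends.loop (T := 14) (Q := fun s' => Frame [20, 21] [] s s' ∧ s'.int 21 0 = m)
    (fun d s' => Frame [20, 21] [] s s' ∧ s'.int 21 0 ≤ m ∧ s'.int 20 0 = K * s'.int 21 0 ∧
      d = m - s'.int 21 0) (m := m) ?_ ?_ ⟨Frame.refl _ _ s, by omega, by simp [h20, h21],
        by omega⟩) fun s₁ hs₁ => (Ends.forRange (N := K) (T := 5)
    (fun l s' => Frame [2, 11, 20, 21] [] s s' ∧ s'.int 11 0 = l ∧ s'.int 21 0 = m ∧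
      ∀ k < l, s'.int 2 k = m) ?_ ?_ ?_ ?_).mono le_rfl fun s' h => ⟨h.1, h.2.2.2⟩).weaken ?_
  · rintro d s' ⟨hf, hle, e20, rfl⟩ hb
    replace hb : s'.int 20 0 < s'.int 0 0 := hb
    rw [hf.int (a := 0) (by decide), h0, e20, hm] at hb
    have hlt := lt_of_mul_lt_mul_left' hb
    have e1 : s'.int 1 0 = K := by rw [hf.int (by decide), h1]
    refine (Ends.straight (by exact ⟨trivial, trivial⟩) ?_).weaken (by decide)
    refine ⟨m - (s'.int 21 0 + 1), by omega, (hf.setInt (by simp) _ _).setInt (by simp) _ _, ?_⟩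
    simp [Prog.exec, IExpr.eval, e20, e1]
    exact ⟨hlt, by ring⟩
  · rintro d s' ⟨hf, hle, e20, rfl⟩ hb
    replace hb : ¬ s'.int 20 0 < s'.int 0 0 := hb
    rw [hf.int (a := 0) (by decide), h0, e20, hm, not_lt] at hb
    exact ⟨hf, le_antisymm hle (Nat.le_of_mul_le_mul_left hb hK)⟩
  · rintro j s' ⟨hf, -, -⟩
    simp [IExpr.eval, hf.int (a := 1) (by decide), h1]
  · exact fun j s' h => h.2.1
  · exact ⟨(hs₁.1.mono (by decide) (by decide)).setInt (by decide) _ _, by simp,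
      by simpa using hs₁.2, by simp⟩
  · rintro l s' hl ⟨hf, h11, e21, h⟩
    refine (Ends.straight (by exact trivial) ?_).weaken (by decide)
    simp only [Prog.exec, IExpr.eval, h11, e21]
    refine ⟨by simpa using h11, (hf.setInt (by simp) _ _).setInt (by simp) _ _, by simp,
      by simpa using e21, fun k hk => ?_⟩
    rcases Nat.lt_succ_iff_lt_or_eq.1 hk with hk | rfl
    · simpa [hk.ne] using h k hk
    · simp
  · have : m ≤ n := by rw [hm]; exact Nat.le_mul_of_pos_left _ hK
    simp only [Test.cost, IExpr.cost]
    omega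

/-- Negate the cost matrix. -/
def negateCosts : Prog :=
  .forRange 11 (.get 7 (.var 0)) (.rset 0 (.var 11) (.sub (.get 1 (.const 0)) (.get 0 (.var 11))))

theorem ends_negateCosts {n N : ℕ} {s : State} (h0 : s.int 0 0 = n) (h7 : s.int 7 n = N)
    (h1 : s.real 1 0 = 0) :
    Ends negateCosts s (50 * N + 50) fun s' => Frame [11] [0] s s' ∧
      ∀ j < N, s'.real 0 j = - s.real 0 j := by
  refine ((Ends.forRange (N := N) (T := 9)
    (fun l s' => Frame [11] [0] s s' ∧ s'.int 11 0 = l ∧ (∀ j < l, s'.real 0 j = - s.real 0 j) ∧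
      ∀ j, l ≤ j → s'.real 0 j = s.real 0 j) ?_ ?_ ?_ ?_).mono ?_ fun s' h => ⟨h.1, h.2.2.1⟩)
  · rintro j s' ⟨hf, -, -⟩
    simp [IExpr.eval, hf.int (a := 0) (by decide), hf.int (a := 7) (by decide), h0, h7]
  · exact fun j s' h => h.2.1
  · exact ⟨(Frame.refl _ _ s).setInt (by decide) _ _, by simp, by simp, by simp⟩
  · rintro l s' hl ⟨hf, h11, h, hrest⟩
    refine (Ends.straight (by exact trivial) ?_).weaken (by decide)
    -- Programs have no real constants; the zero for the negation is read from the untouched real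
    -- array `1`.
    have e1 : s'.real 1 0 = 0 := by rw [hf.real (by decide), h1]
    simp only [Prog.exec, IExpr.eval, RExpr.eval, h11, e1, hrest l le_rfl, zero_sub]
    refine ⟨by simpa using h11, (hf.setReal (by simp) _ _).setInt (by simp) _ _, by simp,
      fun j hj => ?_, fun j hj => ?_⟩
    · rcases Nat.lt_succ_iff_lt_or_eq.1 hj with hj | rfl
      · simpa [hj.ne] using h j hj
      · simp
    · have : j ≠ l := by omega
      simpa [this] using hrest j (by omega)
  · simp only [IExpr.cost]
    omega

/-- Project onto the balanced clustering matrices. -/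
def project : Prog := .seq (.seq equalDemands (.seq rowTable negateCosts)) solve

theorem ends_project {n K m : ℕ} {s : State} (hn : 0 < n) (hm : n = K * m) (h0 : s.int 0 0 = n)
    (h1 : s.int 1 0 = K) (hz : ∀ a, 3 ≤ a → ∀ j, s.int a j = 0) (hr : s.real 1 0 = 0) :
    Ends project s (7000 * (K * K * n * (Nat.log 2 n + 1))) fun s' => ∃ (a : ℕ → ℕ) (v : ℕ → ℝ),
      (∀ r < n, a r < K) ∧
      (∀ k < K, ((Finset.range n).filter (a · = k)).card = m) ∧
      DualFeasible n K (fun r l => - s.real 0 (r * K + l)) a v ∧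
      ∀ i < n, ∀ k < K, s'.int 3 (i * K + k) = if a i = k then 1 else 0 := by
  have hK : 1 ≤ K := by
    by_contra hK
    have : K = 0 := by omega
    subst this
    omega
  refine (Ends.seq (R := fun s' => Frame [2, 7, 11, 20, 21] [0] s s' ∧ (∀ k < K, s'.int 2 k = m) ∧
      ∀ j < n * K, s'.real 0 j = - s.real 0 j)
    (T := (50 * n + 50 * K + 50) + ((50 * (n + K) + 50) + (50 * (n * K) + 50)))
    (T' := 6000 * (K * K * n * (Nat.log 2 n + 1))) ?_ ?_).weaken ?_
  · refine (ends_equalDemands hK h0 h1 hm (hz _ (by omega) _) (hz _ (by omega) _)).seq ?_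
    rintro s₁ ⟨hf₁, h2⟩
    refine (ends_rowTable (n := n) (K := K) (by rw [hf₁.int (by decide), h0])
      (by rw [hf₁.int (by decide), h1])).seq ?_
    rintro s₂ ⟨hf₂, h7⟩
    have g₂ : Frame [2, 7, 11, 20, 21] [0] s s₂ :=
      (hf₁.mono (by decide) (by decide)).trans (hf₂.mono (by decide) (by decide))
    refine (ends_negateCosts (n := n) (N := n * K) (by rw [g₂.int (by decide), h0])
      (h7 n (by omega)) (by rw [g₂.real (by decide), hr])).mono le_rfl ?_
    rintro s₃ ⟨hf₃, h3⟩
    refine ⟨g₂.trans (hf₃.mono (by decide) (by decide)), fun k hk => ?_, fun j hj => ?_⟩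
    · rw [hf₃.int (by decide), hf₂.int (by decide), h2 k hk]
    · rw [h3 j hj, hf₂.real (by decide), hf₁.real (by decide)]
  · rintro s₁ ⟨hf, h2, hneg⟩
    -- The cells left dirty by the preprocessing are harmless: `solve` needs zeros only in the
    -- arrays `3`, `5` and `9`.
    refine (ends_solve hn (by rw [hf.int (by decide), h0]) (by rw [hf.int (by decide), h1])
      (fun j => by rw [hf.int (by decide), hz 3 (by omega)])
      (fun j => by rw [hf.int (by decide), hz 5 (by omega)])
      (fun j => by rw [hf.int (by decide), hz 9 (by omega)]) ?_).mono le_rfl ?_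
    · rw [Finset.sum_congr rfl fun k hk => h2 k (Finset.mem_range.1 hk), hm]
      simp
    · rintro s' ⟨a, v, ha, hcard, hd, hout⟩
      refine ⟨a, v, ha, fun k hk => by rw [hcard k hk, h2 k hk], fun r hr har q hq => ?_, hout⟩
      -- Only addresses below `n * K` were negated.
      have hlt : ∀ q < K, r * K + q < n * K := fun q hq => by
        have : (r + 1) * K ≤ n * K := Nat.mul_le_mul_right _ hr
        rw [Nat.succ_mul] at this
        omega
      have := hd r hr har q hq
      simpa only [hneg _ (hlt _ har), hneg _ (hlt q hq)] using this
  · have h2 : n * K ≤ K * K * n * (Nat.log 2 n + 1) := by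
      calc n * K = 1 * K * n * 1 := by ring
        _ ≤ _ := by gcongr; omega
    have h3 : n ≤ n * K := Nat.le_mul_of_pos_right _ hK
    have h4 : K ≤ n * K := Nat.le_mul_of_pos_left _ hn
    omega

/-! ### Real-valued bounds and reading the output -/

/-- For `n ≥ 2` the binary logarithm is at least 1 and absorbs the summand 1; this is the source of
the factor 2. -/
theorem log_two_add_one_le {n : ℕ} (hn : 2 ≤ n) :
    ((Nat.log 2 n + 1 : ℕ) : ℝ) ≤ 2 / Real.log 2 * Real.log n := by
  have h2 : 0 < Real.log 2 := Real.log_pos one_lt_two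
  have h1 : (Nat.log 2 n : ℝ) ≤ Real.log n / Real.log 2 := Real.natLog_le_logb n 2
  have h3 : 1 ≤ Real.log n / Real.log 2 := by
    rw [le_div_iff₀ h2, one_mul]
    exact Real.log_le_log two_pos (by exact_mod_cast hn)
  push_cast
  calc (Nat.log 2 n : ℝ) + 1 ≤ Real.log n / Real.log 2 + Real.log n / Real.log 2 := by gcongr
    _ = _ := by ring

theorem bound_le {n K A : ℕ} (hn : 2 ≤ n) :
    ((A * (K * K * n * (Nat.log 2 n + 1)) : ℕ) : ℝ) ≤
      A * (2 / Real.log 2) * ((K : ℝ) ^ 2 * n * Real.log n) := by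
  have h := mul_le_mul_of_nonneg_left (log_two_add_one_le hn)
    (show (0 : ℝ) ≤ A * (K * K * n) by positivity)
  push_cast at h ⊢
  calc (A : ℝ) * (K * K * n * (Nat.log 2 n + 1)) = A * (K * K * n) * (Nat.log 2 n + 1) := by ring
    _ ≤ _ := h
    _ = _ := by ring

theorem card_filter_fin {n K : ℕ} {a : ℕ → ℕ} {b : Fin n → Fin K} (hab : ∀ i, (b i : ℕ) = a i)
    (k : Fin K) : (Finset.univ.filter (b · = k)).card =
      ((Finset.range n).filter (a · = (k : ℕ))).card := by
  rw [Finset.card_filter, Finset.card_filter, Finset.sum_range]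
  exact Finset.sum_congr rfl fun i _ => by simp only [Fin.ext_iff, hab]

/-- The output matrix of an optimal assignment. -/
theorem outputMatrix_mem {n K : ℕ} {C : Matrix (Fin n) (Fin K) ℝ} {c : ℕ → ℕ → ℝ}
    (hc : ∀ (i : Fin n) (k : Fin K), c i k = C i k) {π : Fin K → ℕ} {a : ℕ → ℕ} {v : ℕ → ℝ}
    {s : State} (ha : ∀ r < n, a r < K)
    (hcard : ∀ k : Fin K, ((Finset.range n).filter (a · = (k : ℕ))).card = π k)
    (hd : DualFeasible n K c a v)
    (hout : ∀ i < n, ∀ k < K, s.int 3 (i * K + k) = if a i = k then 1 else 0) :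
    outputMatrix n K s ∈
      MCAP.biadjacency '' {G : MCAP.BipSubgraph n K | MCAP.IsMinCostAssignment C π G} := by
  let b : Fin n → Fin K := fun i => ⟨a i, ha i i.2⟩
  refine ⟨MCAP.ofFun b, ⟨MCAP.isAssignment_iff.2 ⟨b, rfl, fun k => ?_⟩, fun G' hG' => ?_⟩, ?_⟩
  · rw [card_filter_fin (a := a) fun i => rfl, hcard]
  · obtain ⟨b', rfl, hb'⟩ := MCAP.isAssignment_iff.1 hG'
    have hK : ∀ i : Fin n, 0 < K := fun i => (Nat.zero_le _).trans_lt (ha i i.2)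
    -- The competitor is extended to all naturals for `DualFeasible.cost_le`; the value 0 beyond `n`
    -- plays no role.
    let a' : ℕ → ℕ := fun r => if h : r < n then b' ⟨r, h⟩ else 0
    have ha' : ∀ i : Fin n, (b' i : ℕ) = a' i := fun i => by simp [a']
    have hle := hd.cost_le (b := a') ha (fun r hr => by simp [a', hr]) fun k hk => by
      rw [hcard ⟨k, hk⟩, ← hb' ⟨k, hk⟩, card_filter_fin ha']
    rw [Finset.sum_range, Finset.sum_range] at hle
    rw [MCAP.cost_ofFun, MCAP.cost_ofFun]
    convert hle using 2 with i _ i _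
    · exact (hc i (b i)).symm
    · rw [← ha' i, hc]
  · ext i k
    rw [MCAP.biadjacency_ofFun, outputMatrix, Matrix.of_apply, hout i i.2 k k.2]
    simp [b, Fin.ext_iff]

theorem inputState_real {n K : ℕ} (C : Matrix (Fin n) (Fin K) ℝ) (π : Fin K → ℕ) (i : Fin n)
    (k : Fin K) : (inputState C π).real 0 (i * K + k) = C i k := by
  have hlt : (i : ℕ) * K + k < n * K := by
    have : ((i : ℕ) + 1) * K ≤ n * K := Nat.mul_le_mul_right _ i.2
    rw [Nat.succ_mul] at this
    have := k.2
    omega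
  have hK : 0 < K := k.pos
  simp only [inputState, true_and, hlt, dite_true]
  congr 1
  · ext
    simp [Nat.add_div_of_dvd_right, Nat.mul_div_cancel _ hK, Nat.div_eq_of_lt k.2]
  · ext
    simp [Nat.mod_eq_of_lt k.2]

theorem inputState_int_of_le {n K : ℕ} (C : Matrix (Fin n) (Fin K) ℝ) (π : Fin K → ℕ) {a : ℕ}
    (ha : 3 ≤ a) (j : ℕ) : (inputState C π).int a j = 0 := by
  simp [inputState, show a ≠ 0 by omega, show a ≠ 1 by omega, show a ≠ 2 by omega]

theorem inputState_int_two {n K : ℕ} (C : Matrix (Fin n) (Fin K) ℝ) (π : Fin K → ℕ) (k : Fin K) :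
    (inputState C π).int 2 k = π k := by
  simp [inputState]

end RealRAM

theorem proposition1 :
    -- the projection problem for `C` is the assignment problem with costs `-C` and `π = m 1`
    (∀ (n K m : ℕ), n = K * m → ∀ C : Matrix (Fin n) (Fin K) ℝ,
      Set.BijOn MCAP.biadjacency
        {G : MCAP.BipSubgraph n K | MCAP.IsAssignment (fun _ => m) G}
        (Clustering.feasible n K m) ∧
      (∀ G G' : MCAP.BipSubgraph n K,
        MCAP.IsAssignment (fun _ => m) G → MCAP.IsAssignment (fun _ => m) G' →
        (Clustering.frobNorm (MCAP.biadjacency G - C) ≤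
            Clustering.frobNorm (MCAP.biadjacency G' - C) ↔
          MCAP.cost (-C) G ≤ MCAP.cost (-C) G')) ∧
      Set.BijOn MCAP.biadjacency
        {G : MCAP.BipSubgraph n K | MCAP.IsMinCostAssignment (-C) (fun _ => m) G}
        (Clustering.proj m C)) ∧
    -- the minimum-cost assignment problem can be solved in `O(K² n log n)` time
    (∃ (p : RealRAM.Prog) (c : ℝ), ∀ (n K : ℕ) (π : Fin K → ℕ), 2 ≤ n → ∑ k, π k = n →
      ∀ C : Matrix (Fin n) (Fin K) ℝ,
        RealRAM.OutputsWithin p (RealRAM.inputState C π)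
          (c * ((K : ℝ) ^ 2 * (n : ℝ) * Real.log (n : ℝ)))
          (MCAP.biadjacency '' {G : MCAP.BipSubgraph n K | MCAP.IsMinCostAssignment C π G})) ∧
    -- the projection can be computed in `O(K² n log n)` time
    (∃ (p : RealRAM.Prog) (c : ℝ), ∀ (n K m : ℕ), 2 ≤ n → n = K * m →
      ∀ C : Matrix (Fin n) (Fin K) ℝ,
        RealRAM.OutputsWithin p (RealRAM.inputState C (fun _ => 0))
          (c * ((K : ℝ) ^ 2 * (n : ℝ) * Real.log (n : ℝ)))
          (Clustering.proj m C)) := by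
  refine ⟨fun n K m _ C => ⟨?_, fun G G' hG hG' => MCAP.frobNorm_biadjacency_le_iff C hG hG', ?_⟩,
    ⟨RealRAM.solve, (6000 : ℕ) * (2 / Real.log 2), fun n K π hn hπ C => ?_⟩,
    ⟨RealRAM.project, (7000 : ℕ) * (2 / Real.log 2), fun n K m hn hm C => ?_⟩⟩
  · rw [MCAP.feasible_eq_image]
    exact (MCAP.injOn_biadjacency _).bijOn_image
  · rw [MCAP.proj_eq_image]
    exact ((MCAP.injOn_biadjacency _).mono fun G hG => hG.1).bijOn_image
  · have hsum : ∑ k ∈ Finset.range K, (RealRAM.inputState C π).int 2 k = n := by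
      rw [Finset.sum_range]
      exact (Finset.sum_congr rfl fun k _ => RealRAM.inputState_int_two C π k).trans hπ
    have hz := fun a ha => RealRAM.inputState_int_of_le C π (a := a) ha
    obtain ⟨t, s', hrun, ht, a, v, ha, hcard, hd, hout⟩ :=
      RealRAM.ends_solve (s := RealRAM.inputState C π) (by omega) (by simp [RealRAM.inputState])
        (by simp [RealRAM.inputState]) (hz 3 (by omega)) (hz 5 (by omega)) (hz 9 (by omega)) hsum
    refine ⟨t, s', hrun, (Nat.cast_le.2 ht).trans (RealRAM.bound_le hn), ?_⟩
    exact RealRAM.outputMatrix_mem (RealRAM.inputState_real C π) ha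
      (fun k => by rw [hcard k k.2, RealRAM.inputState_int_two]) hd hout
  · obtain ⟨t, s', hrun, ht, a, v, ha, hcard, hd, hout⟩ :=
      RealRAM.ends_project (s := RealRAM.inputState C fun _ => 0) (by omega) hm
        (by simp [RealRAM.inputState]) (by simp [RealRAM.inputState])
        (fun a ha => RealRAM.inputState_int_of_le C _ ha) (by simp [RealRAM.inputState])
    refine ⟨t, s', hrun, (Nat.cast_le.2 ht).trans (RealRAM.bound_le hn), ?_⟩
    rw [MCAP.proj_eq_image]
    exact RealRAM.outputMatrix_mem
      (fun i k => by rw [RealRAM.inputState_real, Matrix.neg_apply]) ha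
      (fun k => hcard k k.2) hd hout
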